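/- Colombeau algebras. Let $\Omega$ be an open subset of $\mathbb R^d$, the closed half plane $[0,\infty)\times\mathbb R$, or a relatively open subset of it. Let $\mathcal E_M(\Omega)$ be the algebra of nets $(u^\varepsilon)_{\varepsilon\in(0,1]}$ of real-valued $C^\infty$ functions on $\Omega$ (smooth up to the part of the boundary contained in $\Omega$) such that for all compact $K\subset\Omega$ and all multi-indices $\alpha$ there is $p\ge 0$ with $\sup_K|\partial^\alpha u^\varepsilon|=O(\varepsilon^{-p})$ as $\varepsilon\downarrow 0$. Let $\mathcal N(\Omega)$ be the ideal of nets of such functions for which $\sup_K|\partial^\alpha u^\varepsilon|=O(\varepsilon^{q})$ for all $K$, $\alpha$ and $q\ge 0$, and put $\mathcal G(\Omega)=\mathcal E_M(\Omega)/\mathcal N(\Omega)$. Derivatives, products, restrictions to relatively open subsets, and the restriction of elements of $\mathcal G([0,\infty)\times\mathbb R)$ to $\{t=0\}$ are defined on representatives. An element of $\mathcal G(\Omega)$ is $\mathcal G^\infty$-regular if it has a representative such that for every compact $K\subset\Omega$ there is one $p\ge 0$ with $\sup_K|\partial^\alpha u^\varepsilon|=O(\varepsilon^{-p})$ for all $\alpha$.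 The $\mathcal G^\infty$-singular support of $U\in\mathcal G(\Omega)$, written $\operatorname{sing\,supp}_{\mathcal G^\infty}U$, is the complement in $\Omega$ of the largest relatively open subset (the union of all relatively open subsets) on which the restriction of $U$ is $\mathcal G^\infty$-regular. Theorem. Let $c_0,c_1>0$ with $c_0\neq c_1$, and let $c(t)=c_0+(c_1-c_0)H(t-1)$, where $H$ is the Heaviside function. Let $\varphi,\psi\in C_0^\infty(\mathbb R)$ be two (possibly equal) mollifiers, each of which is symmetric, has support in $[-1,1]$, has nonnegative derivative on $[-1,0]$, and has integral $1$. Put $\varphi_\varepsilon(x)=\varphi(x/\varepsilon)/\varepsilon$ and $\psi_\varepsilon(x)=\psi(x/\varepsilon)/\varepsilon$. Let $C\in\mathcal G([0,\infty)\times\mathbb R)$ be the class of $\big((t,x)\mapsto(c*\varphi_\varepsilon)(t)\big)_{\varepsilon\in(0,1]}$ and let $U_1\in\mathcal G(\mathbb R)$ be the class of $(\psi_\varepsilon)_{\varepsilon\in(0,1]}$. If $U\in\mathcal G([0,\infty)\times\mathbb R)$ is the solution of $$\partial_t^2U-C^2\,\partial_x^2U=0\ \text{ in }\mathcal G([0,\infty)\times\mathbb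 R),\qquad U|_{t=0}=0,\quad \partial_tU|_{t=0}=U_1\ \text{ in }\mathcal G(\mathbb R),$$ then $$\operatorname{sing\,supp}_{\mathcal G^\infty}U=\Big\{(t,x): x=\pm\int_0^t c(s)\,ds,\ t\ge 0\Big\}\cup\Big\{(t,x): x=\pm\Big(2\int_0^1 c(s)\,ds-\int_0^t c(s)\,ds\Big),\ t\ge 1\Big\}.$$ -/

import Mathlib

open Set Filter Topology MeasureTheory
open scoped ContDiff

noncomputable section

namespace Colombeau

variable {E : Type*} [NormedAddCommGroup E] [NormedSpace ℝ E]

/-- The domains on which generalized functions live: sets having unique derivatives, such as open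
sets, closed half spaces, and relatively open subsets of closed half spaces. -/
structure Domain (E : Type*) [NormedAddCommGroup E] [NormedSpace ℝ E] where
  carrier : Set E
  uniqueDiffOn : UniqueDiffOn ℝ carrier

/-- The whole space as a domain. -/
def Domain.whole (E : Type*) [NormedAddCommGroup E] [NormedSpace ℝ E] : Domain E :=
  ⟨univ, uniqueDiffOn_univ⟩

/-- The relatively open subset `Ω ∩ O` of `Ω`, for `O` open. -/
def Domain.inter (Ω : Domain E) (O : TopologicalSpace.Opens E) : Domain E :=
  ⟨Ω.carrier ∩ O, Ω.uniqueDiffOn.inter O.isOpen⟩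

/-- The closed half plane `[0,∞) × ℝ`, with points `(t, x)`. -/
def halfPlane : Domain (ℝ × ℝ) :=
  ⟨Ici (0 : ℝ) ×ˢ univ, (uniqueDiffOn_Ici 0).prod uniqueDiffOn_univ⟩

/-- The parameter interval `(0,1]`. -/
abbrev Scale : Type := ↥(Ioc (0 : ℝ) 1)

/-- All derivatives of order `n` of the net `u` are `O(ε ^ r)` as `ε ↓ 0`, uniformly on `K`.
The derivatives are taken within `Ω` (one-sided at boundary points belonging to `Ω`); the norm of
the `n`-th Fréchet derivative controls, and is controlled by, the partial derivatives `∂^α` with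
`|α| = n`. -/
def DerivBound (Ω : Domain E) (K : Set E) (n : ℕ) (r : ℝ) (u : Scale → E → ℝ) : Prop :=
  ∃ C : ℝ, ∃ η : ℝ, 0 < η ∧ ∀ ε : Scale, (ε : ℝ) < η → ∀ x ∈ K,
    ‖iteratedFDerivWithin ℝ n (u ε) Ω.carrier x‖ ≤ C * (ε : ℝ) ^ r

/-- Moderate nets of smooth functions. -/
def IsModerate (Ω : Domain E) (u : Scale → E → ℝ) : Prop :=
  (∀ ε, ContDiffOn ℝ ∞ (u ε) Ω.carrier) ∧
    ∀ K : Set E, IsCompact K → K ⊆ Ω.carrier → ∀ n : ℕ, ∃ p : ℝ, 0 ≤ p ∧ DerivBound Ω K n (-p) u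

/-- Negligible nets of smooth functions. -/
def IsNegligible (Ω : Domain E) (u : Scale → E → ℝ) : Prop :=
  (∀ ε, ContDiffOn ℝ ∞ (u ε) Ω.carrier) ∧
    ∀ K : Set E, IsCompact K → K ⊆ Ω.carrier → ∀ n : ℕ, ∀ q : ℝ, 0 ≤ q → DerivBound Ω K n q u

/-- Nets all of whose derivatives have, locally, one common order of growth. -/
def IsRegularNet (Ω : Domain E) (u : Scale → E → ℝ) : Prop :=
  ∀ K : Set E, IsCompact K → K ⊆ Ω.carrier → ∃ p : ℝ, 0 ≤ p ∧ ∀ n : ℕ, DerivBound Ω K n (-p) u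

theorem DerivBound.congr {E' : Type*} [NormedAddCommGroup E'] [NormedSpace ℝ E']
    {Ω : Domain E} {Ω' : Domain E'} {K : Set E} {K' : Set E'} {n n' : ℕ} {r : ℝ}
    {u : Scale → E → ℝ} {v : Scale → E' → ℝ} (M : ℝ) (hM : 0 ≤ M)
    (h : ∀ ε, ∀ y ∈ K', ∃ x ∈ K, ‖iteratedFDerivWithin ℝ n' (v ε) Ω'.carrier y‖ ≤
      M * ‖iteratedFDerivWithin ℝ n (u ε) Ω.carrier x‖)
    (hu : DerivBound Ω K n r u) : DerivBound Ω' K' n' r v := by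
  obtain ⟨C, η, hη, hC⟩ := hu
  refine ⟨M * C, η, hη, fun ε hε y hy => ?_⟩
  obtain ⟨x, hx, hxy⟩ := h ε y hy
  calc _ ≤ _ := hxy
    _ ≤ M * (C * (ε : ℝ) ^ r) := mul_le_mul_of_nonneg_left (hC ε hε x hx) hM
    _ = _ := by ring

theorem DerivBound.mono {Ω : Domain E} {K : Set E} {n : ℕ} {r s : ℝ}
    {u : Scale → E → ℝ} (hu : DerivBound Ω K n r u) (h : s ≤ r) : DerivBound Ω K n s u := by
  obtain ⟨C, η, hη, hC⟩ := hu
  refine ⟨|C|, η, hη, fun ε hε x hx => (hC ε hε x hx).trans ?_⟩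
  have h1 : (ε : ℝ) ^ r ≤ (ε : ℝ) ^ s := Real.rpow_le_rpow_of_exponent_ge ε.2.1 ε.2.2 h
  have h2 : 0 ≤ (ε : ℝ) ^ r := Real.rpow_nonneg ε.2.1.le _
  exact mul_le_mul (le_abs_self C) h1 h2 (abs_nonneg C)

theorem DerivBound.add {Ω : Domain E} {K : Set E} (hK : K ⊆ Ω.carrier) {n : ℕ} {r : ℝ}
    {u v : Scale → E → ℝ} (hus : ∀ ε, ContDiffOn ℝ ∞ (u ε) Ω.carrier)
    (hvs : ∀ ε, ContDiffOn ℝ ∞ (v ε) Ω.carrier)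
    (hu : DerivBound Ω K n r u) (hv : DerivBound Ω K n r v) : DerivBound Ω K n r (u + v) := by
  obtain ⟨C, η, hη, hC⟩ := hu
  obtain ⟨D, θ, hθ, hD⟩ := hv
  refine ⟨C + D, min η θ, lt_min hη hθ, fun ε hε x hx => ?_⟩
  have h1 := hC ε (hε.trans_le (min_le_left _ _)) x hx
  have h2 := hD ε (hε.trans_le (min_le_right _ _)) x hx
  have h3 : iteratedFDerivWithin ℝ n ((u + v) ε) Ω.carrier x =
      iteratedFDerivWithin ℝ n (u ε) Ω.carrier x + iteratedFDerivWithin ℝ n (v ε) Ω.carrier x :=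
    iteratedFDerivWithin_add_apply (((hus ε) x (hK hx)).of_le (by exact_mod_cast le_top))
      (((hvs ε) x (hK hx)).of_le (by exact_mod_cast le_top)) Ω.uniqueDiffOn (hK hx)
  rw [h3, add_mul]
  exact (norm_add_le _ _).trans (add_le_add h1 h2)

theorem DerivBound.mul {Ω : Domain E} {K : Set E} (hK : K ⊆ Ω.carrier) {n : ℕ} {r s : ℝ}
    {u v : Scale → E → ℝ} (hus : ∀ ε, ContDiffOn ℝ ∞ (u ε) Ω.carrier)
    (hvs : ∀ ε, ContDiffOn ℝ ∞ (v ε) Ω.carrier)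
    (hu : ∀ i ≤ n, DerivBound Ω K i r u) (hv : ∀ i ≤ n, DerivBound Ω K i s v) :
    DerivBound Ω K n (r + s) (u * v) := by
  choose! C η hη hC using hu
  choose! D θ hθ hD using hv
  have hne : (Finset.range (n + 1)).Nonempty := ⟨0, by simp⟩
  refine ⟨∑ i ∈ Finset.range (n + 1), (n.choose i : ℝ) * |C i| * |D (n - i)|,
    min ((Finset.range (n + 1)).inf' hne η) ((Finset.range (n + 1)).inf' hne θ),
    lt_min ?_ ?_, fun ε hε x hx => ?_⟩
  · rw [Finset.lt_inf'_iff]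
    intro i hi
    exact hη i (by simpa [Nat.lt_succ_iff] using hi)
  · rw [Finset.lt_inf'_iff]
    intro i hi
    exact hθ i (by simpa [Nat.lt_succ_iff] using hi)
  have h := norm_iteratedFDerivWithin_mul_le (hus ε) (hvs ε) Ω.uniqueDiffOn (hK hx)
    (n := n) (by exact_mod_cast le_top)
  refine (le_of_eq_of_le rfl h).trans ?_
  rw [Finset.sum_mul]
  refine Finset.sum_le_sum fun i hi => ?_
  have hi' : i ≤ n := by simpa [Nat.lt_succ_iff] using hi
  have e1 := hC i hi' ε (hε.trans_le ((min_le_left _ _).trans (Finset.inf'_le _ hi))) x hx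
  have e2 := hD (n - i) (Nat.sub_le _ _) ε
    (hε.trans_le ((min_le_right _ _).trans (Finset.inf'_le _ (by simp)))) x hx
  have p1 : 0 ≤ (ε : ℝ) ^ r := Real.rpow_nonneg ε.2.1.le _
  have p2 : 0 ≤ (ε : ℝ) ^ s := Real.rpow_nonneg ε.2.1.le _
  have e1' := e1.trans (mul_le_mul_of_nonneg_right (le_abs_self (C i)) p1)
  have e2' := e2.trans (mul_le_mul_of_nonneg_right (le_abs_self (D (n - i))) p2)
  rw [Real.rpow_add ε.2.1]
  calc _ ≤ (n.choose i : ℝ) * (|C i| * (ε : ℝ) ^ r) * (|D (n - i)| * (ε : ℝ) ^ s) := by gcongr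
    _ = _ := by ring

theorem IsModerate.uniform {Ω : Domain E} {u : Scale → E → ℝ} (hu : IsModerate Ω u)
    {K : Set E} (hK : IsCompact K) (hKΩ : K ⊆ Ω.carrier) (n : ℕ) :
    ∃ p : ℝ, 0 ≤ p ∧ ∀ i ≤ n, DerivBound Ω K i (-p) u := by
  choose p hp hb using hu.2 K hK hKΩ
  refine ⟨∑ i ∈ Finset.range (n + 1), p i, Finset.sum_nonneg fun i _ => hp i, fun i hi => ?_⟩
  refine (hb i).mono (neg_le_neg ?_)
  exact Finset.single_le_sum (f := p) (fun j _ => hp j) (by simp; omega)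

theorem IsModerate.mul {Ω : Domain E} {u v : Scale → E → ℝ} (hu : IsModerate Ω u)
    (hv : IsModerate Ω v) : IsModerate Ω (u * v) := by
  refine ⟨fun ε => (hu.1 ε).mul (hv.1 ε), fun K hK hKΩ n => ?_⟩
  obtain ⟨p, hp, hup⟩ := hu.uniform hK hKΩ n
  obtain ⟨q, hq, hvq⟩ := hv.uniform hK hKΩ n
  refine ⟨p + q, add_nonneg hp hq, ?_⟩
  rw [neg_add]
  exact DerivBound.mul hKΩ hu.1 hv.1 hup hvq

theorem IsModerate.add {Ω : Domain E} {u v : Scale → E → ℝ} (hu : IsModerate Ω u)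
    (hv : IsModerate Ω v) : IsModerate Ω (u + v) := by
  refine ⟨fun ε => (hu.1 ε).add (hv.1 ε), fun K hK hKΩ n => ?_⟩
  obtain ⟨p, hp, hup⟩ := hu.2 K hK hKΩ n
  obtain ⟨q, hq, hvq⟩ := hv.2 K hK hKΩ n
  exact ⟨p + q, add_nonneg hp hq, DerivBound.add hKΩ hu.1 hv.1 (hup.mono (by linarith))
    (hvq.mono (by linarith))⟩

theorem IsModerate.const (Ω : Domain E) (a : ℝ) : IsModerate Ω (fun _ _ => a) := by
  refine ⟨fun ε => contDiffOn_const, fun K _ hKΩ n => ⟨0, le_rfl, ?_⟩⟩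
  refine ⟨|a|, 1, one_pos, fun ε _ x hx => ?_⟩
  rcases Nat.eq_zero_or_pos n with rfl | hn
  · simp
  · rw [iteratedFDerivWithin_const_of_ne hn.ne']
    simp

theorem IsNegligible.add {Ω : Domain E} {u v : Scale → E → ℝ} (hu : IsNegligible Ω u)
    (hv : IsNegligible Ω v) : IsNegligible Ω (u + v) :=
  ⟨fun ε => (hu.1 ε).add (hv.1 ε), fun K hK hKΩ n q hq =>
    DerivBound.add hKΩ hu.1 hv.1 (hu.2 K hK hKΩ n q hq) (hv.2 K hK hKΩ n q hq)⟩

theorem IsNegligible.zero (Ω : Domain E) : IsNegligible Ω (0 : Scale → E → ℝ) := by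
  exact ⟨fun ε => contDiffOn_const, fun K _ hKΩ n q _ => ⟨0, 1, one_pos, fun ε _ x hx => by simp⟩⟩

theorem DerivBound.congr_on {Ω : Domain E} {K : Set E} (hK : K ⊆ Ω.carrier) {n : ℕ} {r : ℝ}
    {u v : Scale → E → ℝ} (h : ∀ ε, EqOn (v ε) (u ε) Ω.carrier) (hu : DerivBound Ω K n r u) :
    DerivBound Ω K n r v :=
  hu.congr 1 zero_le_one fun ε y hy => ⟨y, hy, by
    rw [iteratedFDerivWithin_congr (h ε) (hK hy), one_mul]⟩

theorem IsNegligible.congr {Ω : Domain E} {u v : Scale → E → ℝ} (hu : IsNegligible Ω u)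
    (h : ∀ ε, EqOn (v ε) (u ε) Ω.carrier) : IsNegligible Ω v :=
  ⟨fun ε => (hu.1 ε).congr (h ε), fun K hK hKΩ n q hq =>
    (hu.2 K hK hKΩ n q hq).congr_on hKΩ h⟩

theorem IsModerate.mul_negligible {Ω : Domain E} {u v : Scale → E → ℝ} (hu : IsModerate Ω u)
    (hv : IsNegligible Ω v) : IsNegligible Ω (u * v) := by
  refine ⟨fun ε => (hu.1 ε).mul (hv.1 ε), fun K hK hKΩ n q hq => ?_⟩
  obtain ⟨p, hp, hup⟩ := hu.uniform hK hKΩ n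
  have h := DerivBound.mul hKΩ hu.1 hv.1 hup
    (fun i _ => hv.2 K hK hKΩ i (p + q) (add_nonneg hp hq))
  simpa using h

/-- The algebra of moderate nets. -/
def moderate (Ω : Domain E) : Subalgebra ℝ (Scale → E → ℝ) where
  carrier := {u | IsModerate Ω u}
  mul_mem' := fun hu hv => IsModerate.mul hu hv
  add_mem' := fun hu hv => IsModerate.add hu hv
  algebraMap_mem' := fun a => IsModerate.const Ω a

/-- The ideal of negligible nets. -/
def negligible (Ω : Domain E) : Ideal (moderate Ω) where
  carrier := {u | IsNegligible Ω u.1}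
  add_mem' := fun hu hv => IsNegligible.add hu hv
  zero_mem' := IsNegligible.zero Ω
  smul_mem' := fun u _ hv => IsModerate.mul_negligible u.2 hv

/-- The Colombeau algebra of generalized functions on `Ω`. -/
abbrev GenFun (Ω : Domain E) : Type _ := moderate Ω ⧸ negligible Ω

/-- The class of a moderate net. -/
def GenFun.mk {Ω : Domain E} (u : Scale → E → ℝ) (hu : IsModerate Ω u) : GenFun Ω :=
  Ideal.Quotient.mk (negligible Ω) ⟨u, hu⟩

/-- Operations on nets that respect equality modulo negligible nets act on generalized
functions. -/
def GenFun.map {E' : Type*} [NormedAddCommGroup E'] [NormedSpace ℝ E']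
    {Ω : Domain E} {Ω' : Domain E'} (f : moderate Ω → moderate Ω')
    (hf : ∀ u v : moderate Ω, IsNegligible Ω (u.1 - v.1) →
      IsNegligible Ω' ((f u).1 - (f v).1)) :
    GenFun Ω → GenFun Ω' :=
  Quotient.map' (s₁ := (negligible Ω).quotientRel) (s₂ := (negligible Ω').quotientRel) f
    fun u v h => (Submodule.quotientRel_def _).2 (hf u v ((Submodule.quotientRel_def _).1 h))

theorem norm_iteratedFDerivWithin_dirDeriv_le {Ω : Domain E} {f : E → ℝ}
    (hf : ContDiffOn ℝ ∞ f Ω.carrier) (v : E) (n : ℕ) {x : E} (hx : x ∈ Ω.carrier) :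
    ‖iteratedFDerivWithin ℝ n (fun y => fderivWithin ℝ f Ω.carrier y v) Ω.carrier x‖ ≤
      ‖v‖ * ‖iteratedFDerivWithin ℝ (n + 1) f Ω.carrier x‖ := by
  have h1 : ContDiffOn ℝ n (fderivWithin ℝ f Ω.carrier) Ω.carrier :=
    hf.fderivWithin Ω.uniqueDiffOn (by exact_mod_cast le_top)
  have h2 := norm_iteratedFDerivWithin_clm_apply_const (c := v) (h1 x hx) Ω.uniqueDiffOn hx
    (le_refl (n : WithTop ℕ∞))
  rwa [norm_iteratedFDerivWithin_fderivWithin Ω.uniqueDiffOn hx] at h2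

theorem contDiffOn_dirDeriv {Ω : Domain E} {f : E → ℝ}
    (hf : ContDiffOn ℝ ∞ f Ω.carrier) (v : E) :
    ContDiffOn ℝ ∞ (fun y => fderivWithin ℝ f Ω.carrier y v) Ω.carrier :=
  (hf.fderivWithin (m := ∞) Ω.uniqueDiffOn (by simp)).clm_apply contDiffOn_const

/-- The directional derivative `∂_v` of a moderate net, taken for each `ε`. -/
def netDeriv {Ω : Domain E} (v : E) (u : moderate Ω) : moderate Ω :=
  ⟨fun ε x => fderivWithin ℝ (u.1 ε) Ω.carrier x v,
    fun ε => contDiffOn_dirDeriv (u.2.1 ε) v, fun K hK hKΩ n => by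
      obtain ⟨p, hp, h⟩ := u.2.2 K hK hKΩ (n + 1)
      exact ⟨p, hp, h.congr ‖v‖ (norm_nonneg v) fun ε x hx =>
        ⟨x, hx, norm_iteratedFDerivWithin_dirDeriv_le (u.2.1 ε) v n (hKΩ hx)⟩⟩⟩

theorem netDeriv_sub_negligible {Ω : Domain E} (v : E) (u w : moderate Ω)
    (h : IsNegligible Ω (u.1 - w.1)) :
    IsNegligible Ω ((netDeriv v u).1 - (netDeriv v w).1) := by
  have key : IsNegligible Ω (fun ε x => fderivWithin ℝ ((u.1 - w.1) ε) Ω.carrier x v) :=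
    ⟨fun ε => contDiffOn_dirDeriv (h.1 ε) v, fun K hK hKΩ n q hq =>
      (h.2 K hK hKΩ (n + 1) q hq).congr ‖v‖ (norm_nonneg v) fun ε x hx =>
        ⟨x, hx, norm_iteratedFDerivWithin_dirDeriv_le (h.1 ε) v n (hKΩ hx)⟩⟩
  refine key.congr fun ε x hx => ?_
  have h1 : DifferentiableWithinAt ℝ (u.1 ε) Ω.carrier x :=
    ((u.2.1 ε) x hx).differentiableWithinAt (by simp)
  have h2 : DifferentiableWithinAt ℝ (w.1 ε) Ω.carrier x :=
    ((w.2.1 ε) x hx).differentiableWithinAt (by simp)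
  have h3 := fderivWithin_sub (Ω.uniqueDiffOn x hx) h1 h2
  change _ = fderivWithin ℝ (u.1 ε - w.1 ε) Ω.carrier x v
  rw [h3]
  rfl

/-- The directional derivative `∂_v U` of a generalized function. -/
def GenFun.deriv {Ω : Domain E} (v : E) : GenFun Ω → GenFun Ω :=
  GenFun.map (netDeriv v) (netDeriv_sub_negligible v)

theorem DerivBound.restrict {Ω : Domain E} {O : TopologicalSpace.Opens E} {K : Set E}
    (hK : K ⊆ (Ω.inter O).carrier) {n : ℕ} {r : ℝ} {u : Scale → E → ℝ}
    (hu : DerivBound Ω K n r u) : DerivBound (Ω.inter O) K n r u :=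
  hu.congr 1 zero_le_one fun ε x hx => ⟨x, hx, by
    rw [one_mul]
    exact (congrArg norm (iteratedFDerivWithin_inter_open O.isOpen (hK hx).2)).le⟩

/-- The restriction of a moderate net to a relatively open subset. -/
def netRestrict {Ω : Domain E} (O : TopologicalSpace.Opens E) (u : moderate Ω) :
    moderate (Ω.inter O) :=
  ⟨u.1, fun ε => (u.2.1 ε).mono inter_subset_left, fun K hK hKΩ n => by
    obtain ⟨p, hp, h⟩ := u.2.2 K hK (hKΩ.trans inter_subset_left) n
    exact ⟨p, hp, h.restrict hKΩ⟩⟩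

/-- The restriction `U|_{Ω ∩ O}` of a generalized function to a relatively open subset. -/
def GenFun.restrict {Ω : Domain E} (O : TopologicalSpace.Opens E) :
    GenFun Ω → GenFun (Ω.inter O) :=
  GenFun.map (netRestrict O) fun _ _ h =>
    ⟨fun ε => (h.1 ε).mono inter_subset_left, fun K hK hKΩ n q hq =>
      (h.2 K hK (hKΩ.trans inter_subset_left) n q hq).restrict hKΩ⟩

/-- The subset `𝒢^∞(Ω)` of regular generalized functions. -/
def GenFun.IsRegular {Ω : Domain E} (U : GenFun Ω) : Prop :=
  ∃ (u : Scale → E → ℝ) (hu : IsModerate Ω u), GenFun.mk u hu = U ∧ IsRegularNet Ω u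

/-- The `𝒢^∞`-singular support: the complement in `Ω` of the largest relatively open set on which
the generalized function is regular, that is, of the union of all such sets. -/
def GenFun.singSupp {Ω : Domain E} (U : GenFun Ω) : Set E :=
  Ω.carrier \ ⋃ (O : TopologicalSpace.Opens E) (_ : (U.restrict O).IsRegular), (O : Set E)

theorem exists_norm_iteratedFDerivWithin_comp_le {E' : Type*} [NormedAddCommGroup E']
    [NormedSpace ℝ E'] {Ω : Domain E} {Ω' : Domain E'} (g : E' →L[ℝ] E)
    (hg : UniqueDiffOn ℝ (g ⁻¹' Ω.carrier)) (hsub : Ω'.carrier ⊆ g ⁻¹' Ω.carrier)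
    {f : E → ℝ} (hf : ContDiffOn ℝ ∞ f Ω.carrier) (n : ℕ) {x : E'} (hx : x ∈ Ω'.carrier) :
    ‖iteratedFDerivWithin ℝ n (fun y => f (g y)) Ω'.carrier x‖ ≤
      ‖g‖ ^ n * ‖iteratedFDerivWithin ℝ n f Ω.carrier (g x)‖ := by
  have hf' : ContDiffOn ℝ n f Ω.carrier := hf.of_le (by exact_mod_cast le_top)
  have h1 := g.iteratedFDerivWithin_comp_right hf' Ω.uniqueDiffOn hg (hsub hx) (le_refl _)
  have h2 : iteratedFDerivWithin ℝ n (f ∘ g) Ω'.carrier x =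
      iteratedFDerivWithin ℝ n (f ∘ g) (g ⁻¹' Ω.carrier) x :=
    iteratedFDerivWithin_subset hsub Ω'.uniqueDiffOn hg
      (hf'.comp g.contDiff.contDiffOn (mapsTo_preimage _ _)) hx
  change ‖iteratedFDerivWithin ℝ n (f ∘ g) Ω'.carrier x‖ ≤ _
  rw [h2, h1]
  refine (ContinuousMultilinearMap.norm_compContinuousLinearMap_le _ _).trans (le_of_eq ?_)
  simp [mul_comm]

theorem DerivBound.comp {E' : Type*} [NormedAddCommGroup E']
    [NormedSpace ℝ E'] {Ω : Domain E} {Ω' : Domain E'} (g : E' →L[ℝ] E)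
    (hg : UniqueDiffOn ℝ (g ⁻¹' Ω.carrier)) (hsub : Ω'.carrier ⊆ g ⁻¹' Ω.carrier)
    {u : Scale → E → ℝ} (hu : ∀ ε, ContDiffOn ℝ ∞ (u ε) Ω.carrier) {K : Set E'}
    (hK : K ⊆ Ω'.carrier) {n : ℕ} {r : ℝ} (h : DerivBound Ω (g '' K) n r u) :
    DerivBound Ω' K n r (fun ε y => u ε (g y)) :=
  h.congr (‖g‖ ^ n) (by positivity) fun ε y hy => ⟨g y, mem_image_of_mem _ hy,
    exists_norm_iteratedFDerivWithin_comp_le g hg hsub (hu ε) n (hK hy)⟩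

theorem IsModerate.comp {E' : Type*} [NormedAddCommGroup E']
    [NormedSpace ℝ E'] {Ω : Domain E} {Ω' : Domain E'} (g : E' →L[ℝ] E)
    (hg : UniqueDiffOn ℝ (g ⁻¹' Ω.carrier)) (hsub : Ω'.carrier ⊆ g ⁻¹' Ω.carrier)
    {u : Scale → E → ℝ} (hu : IsModerate Ω u) : IsModerate Ω' (fun ε y => u ε (g y)) :=
  ⟨fun ε => (hu.1 ε).comp g.contDiff.contDiffOn hsub, fun K hK hKΩ n => by
    obtain ⟨p, hp, h⟩ := hu.2 (g '' K) (hK.image g.continuous)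
      (image_subset_iff.2 (hKΩ.trans hsub)) n
    exact ⟨p, hp, h.comp g hg hsub hu.1 hKΩ⟩⟩

theorem IsNegligible.comp {E' : Type*} [NormedAddCommGroup E']
    [NormedSpace ℝ E'] {Ω : Domain E} {Ω' : Domain E'} (g : E' →L[ℝ] E)
    (hg : UniqueDiffOn ℝ (g ⁻¹' Ω.carrier)) (hsub : Ω'.carrier ⊆ g ⁻¹' Ω.carrier)
    {u : Scale → E → ℝ} (hu : IsNegligible Ω u) : IsNegligible Ω' (fun ε y => u ε (g y)) :=
  ⟨fun ε => (hu.1 ε).comp g.contDiff.contDiffOn hsub, fun K hK hKΩ n q hq =>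
    (hu.2 (g '' K) (hK.image g.continuous)
      (image_subset_iff.2 (hKΩ.trans hsub)) n q hq).comp g hg hsub hu.1 hKΩ⟩

theorem inr_preimage_halfPlane :
    (ContinuousLinearMap.inr ℝ ℝ ℝ) ⁻¹' halfPlane.carrier = univ := by
  ext y; simp [halfPlane]

/-- The restriction `x ↦ u^ε(0, x)` of a moderate net on the half plane to the line `t = 0`. -/
def netTrace (u : moderate halfPlane) : moderate (Domain.whole ℝ) :=
  ⟨fun ε x => u.1 ε (0, x), u.2.comp (Ω' := Domain.whole ℝ) (ContinuousLinearMap.inr ℝ ℝ ℝ)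
    (by rw [inr_preimage_halfPlane]; exact uniqueDiffOn_univ)
    (by rw [inr_preimage_halfPlane]; exact subset_univ _)⟩

/-- The restriction `U|_{t = 0}` of a generalized function on the half plane. -/
def GenFun.trace : GenFun halfPlane → GenFun (Domain.whole ℝ) :=
  GenFun.map netTrace fun _ _ h =>
    h.comp (Ω' := Domain.whole ℝ) (ContinuousLinearMap.inr ℝ ℝ ℝ)
      (by rw [inr_preimage_halfPlane]; exact uniqueDiffOn_univ)
      (by rw [inr_preimage_halfPlane]; exact subset_univ _)

/-- The derivative `∂_t` on the half plane. -/
def GenFun.dt : GenFun halfPlane → GenFun halfPlane := GenFun.deriv ((1, 0) : ℝ × ℝ)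

/-- The derivative `∂_x` on the half plane. -/
def GenFun.dx : GenFun halfPlane → GenFun halfPlane := GenFun.deriv ((0, 1) : ℝ × ℝ)

/-- `U` solves `∂_t² U - C² ∂_x² U = 0` in `𝒢([0,∞) × ℝ)` with `U = U₀` and `∂_t U = U₁` at
`t = 0` in `𝒢(ℝ)`. -/
structure IsWaveSolution (C : GenFun halfPlane) (U₀ U₁ : GenFun (Domain.whole ℝ))
    (U : GenFun halfPlane) : Prop where
  equation : U.dt.dt - C ^ 2 * U.dx.dx = 0
  initial : U.trace = U₀
  initial_dt : U.dt.trace = U₁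

/-- The mollifiers: symmetric test functions supported in `[-1, 1]`, nondecreasing on `[-1, 0]`
and with integral one. -/
structure Mollifier where
  toFun : ℝ → ℝ
  smooth : ContDiff ℝ ∞ toFun
  symmetric : ∀ x, toFun (-x) = toFun x
  deriv_nonneg : ∀ x ∈ Icc (-1 : ℝ) 0, 0 ≤ _root_.deriv toFun x
  supp : tsupport toFun ⊆ Icc (-1) 1
  integral_eq_one : ∫ x, toFun x = 1

/-- The scaled mollifier `φ_ε(x) = φ(x / ε) / ε`. -/
def Mollifier.scaled (φ : Mollifier) (ε : Scale) (x : ℝ) : ℝ := φ.toFun (x / ε) / ε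

theorem Mollifier.hasCompactSupport (φ : Mollifier) : HasCompactSupport φ.toFun :=
  isCompact_Icc.of_isClosed_subset (isClosed_tsupport _) φ.supp

theorem Mollifier.scaled_eq (φ : Mollifier) (ε : Scale) :
    φ.scaled ε = fun x => (ε : ℝ)⁻¹ * φ.toFun ((ε : ℝ)⁻¹ * x) := by
  ext x
  simp [Mollifier.scaled, div_eq_inv_mul]

theorem Mollifier.contDiff_scaled (φ : Mollifier) (ε : Scale) : ContDiff ℝ ∞ (φ.scaled ε) := by
  rw [φ.scaled_eq]
  exact contDiff_const.mul (φ.smooth.comp (contDiff_const.mul contDiff_id))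

theorem Mollifier.hasCompactSupport_scaled (φ : Mollifier) (ε : Scale) :
    HasCompactSupport (φ.scaled ε) := by
  rw [φ.scaled_eq]
  have h := φ.hasCompactSupport.comp_smul (inv_ne_zero ε.2.1.ne')
  exact h.mul_left (f := fun _ => (ε : ℝ)⁻¹)

theorem Mollifier.iteratedDeriv_scaled (φ : Mollifier) (ε : Scale) (n : ℕ) (x : ℝ) :
    iteratedDeriv n (φ.scaled ε) x =
      (ε : ℝ)⁻¹ ^ (n + 1) * iteratedDeriv n φ.toFun ((ε : ℝ)⁻¹ * x) := by
  rw [φ.scaled_eq, iteratedDeriv_const_mul_field, iteratedDeriv_comp_const_mul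
    (φ.smooth.of_le (by exact_mod_cast le_top))]
  ring

theorem Mollifier.continuous_iteratedDeriv (φ : Mollifier) (n : ℕ) :
    Continuous (iteratedDeriv n φ.toFun) :=
  φ.smooth.continuous_iteratedDeriv n (by exact_mod_cast le_top)

theorem hasCompactSupport_iteratedDeriv {f : ℝ → ℝ} (hf : HasCompactSupport f) (n : ℕ) :
    HasCompactSupport (iteratedDeriv n f) := by
  induction n with
  | zero => simpa using hf
  | succ n ih => rw [iteratedDeriv_succ]; exact ih.deriv

theorem isModerate_of_iteratedDeriv_le {u : Scale → ℝ → ℝ} (hu : ∀ ε, ContDiff ℝ ∞ (u ε))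
    (h : ∀ n : ℕ, ∃ C : ℝ, ∃ m : ℕ, ∀ ε x, |iteratedDeriv n (u ε) x| ≤ C * (ε : ℝ)⁻¹ ^ m) :
    IsModerate (Domain.whole ℝ) u := by
  refine ⟨fun ε => (hu ε).contDiffOn, fun K _ _ n => ?_⟩
  obtain ⟨C, m, hC⟩ := h n
  refine ⟨m, Nat.cast_nonneg m, C, 1, one_pos, fun ε _ x _ => ?_⟩
  have h1 : (ε : ℝ) ^ (-(m : ℝ)) = (ε : ℝ)⁻¹ ^ m := by
    rw [Real.rpow_neg ε.2.1.le, Real.rpow_natCast, inv_pow]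
  rw [h1]
  have h2 : iteratedFDerivWithin ℝ n (u ε) (Domain.whole ℝ).carrier x =
      iteratedFDeriv ℝ n (u ε) x := by
    rw [← iteratedFDerivWithin_univ]; rfl
  rw [h2, norm_iteratedFDeriv_eq_norm_iteratedDeriv]
  exact hC ε x

theorem Mollifier.isModerate_scaled (φ : Mollifier) : IsModerate (Domain.whole ℝ) φ.scaled := by
  refine isModerate_of_iteratedDeriv_le φ.contDiff_scaled fun n => ?_
  obtain ⟨A, hA⟩ := (hasCompactSupport_iteratedDeriv φ.hasCompactSupport n).exists_bound_of_continuous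
    (φ.continuous_iteratedDeriv n)
  refine ⟨A, n + 1, fun ε x => ?_⟩
  have h0 : 0 ≤ (ε : ℝ)⁻¹ := inv_nonneg.2 ε.2.1.le
  rw [φ.iteratedDeriv_scaled, abs_mul, abs_of_nonneg (pow_nonneg h0 _), mul_comm]
  exact mul_le_mul_of_nonneg_right (hA _) (pow_nonneg h0 _)

/-- The regularized delta function, the class of `(φ_ε)` in `𝒢(ℝ)`. -/
def Mollifier.delta (φ : Mollifier) : GenFun (Domain.whole ℝ) :=
  GenFun.mk φ.scaled φ.isModerate_scaled

/-- The regularization `f ∗ φ_ε` of a function on the line. -/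
def Mollifier.regularize (φ : Mollifier) (f : ℝ → ℝ) (ε : Scale) : ℝ → ℝ :=
  convolution f (φ.scaled ε) (ContinuousLinearMap.mul ℝ ℝ) volume

theorem iteratedDeriv_convolution {f g : ℝ → ℝ} (hf : LocallyIntegrable f)
    (hg : HasCompactSupport g) (hgs : ContDiff ℝ ∞ g) (n : ℕ) :
    iteratedDeriv n (convolution f g (ContinuousLinearMap.mul ℝ ℝ) volume) =
      convolution f (iteratedDeriv n g) (ContinuousLinearMap.mul ℝ ℝ) volume := by
  induction n with
  | zero => simp
  | succ n ih =>
    rw [iteratedDeriv_succ, ih]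
    ext x
    rw [iteratedDeriv_succ]
    refine ((hasCompactSupport_iteratedDeriv hg n).hasDerivAt_convolution_right
      (ContinuousLinearMap.mul ℝ ℝ) hf ?_ x).deriv
    rw [iteratedDeriv_eq_iterate]
    exact (hgs.iterate_deriv n).of_le (by exact_mod_cast le_top)

theorem Mollifier.isModerate_regularize (φ : Mollifier) {f : ℝ → ℝ} (hf : LocallyIntegrable f)
    (M : ℝ) (hM : ∀ x, |f x| ≤ M) : IsModerate (Domain.whole ℝ) (φ.regularize f) := by
  refine isModerate_of_iteratedDeriv_le (fun ε => (φ.hasCompactSupport_scaled ε).contDiff_convolution_right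
    _ hf (φ.contDiff_scaled ε)) fun n => ?_
  refine ⟨M * ∫ y, |iteratedDeriv n φ.toFun y|, n, fun ε x => ?_⟩
  have hε : 0 < (ε : ℝ) := ε.2.1
  rw [Mollifier.regularize, iteratedDeriv_convolution hf (φ.hasCompactSupport_scaled ε)
    (φ.contDiff_scaled ε), convolution]
  have hint : Integrable (iteratedDeriv n (φ.scaled ε)) :=
    ((φ.contDiff_scaled ε).continuous_iteratedDeriv n
      (by exact_mod_cast le_top)).integrable_of_hasCompactSupport
      (hasCompactSupport_iteratedDeriv (φ.hasCompactSupport_scaled ε) n)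
  have h1 : ∫ t, |iteratedDeriv n (φ.scaled ε) (x - t)| =
      (ε : ℝ)⁻¹ ^ n * ∫ y, |iteratedDeriv n φ.toFun y| := by
    rw [integral_sub_left_eq_self (fun t => |iteratedDeriv n (φ.scaled ε) t|) volume x]
    simp_rw [φ.iteratedDeriv_scaled, abs_mul]
    rw [integral_const_mul, Measure.integral_comp_mul_left
      (fun y => |iteratedDeriv n φ.toFun y|)]
    rw [abs_of_nonneg (by positivity), inv_inv, abs_of_pos hε, smul_eq_mul, pow_succ]
    field_simp
  calc |∫ t, (ContinuousLinearMap.mul ℝ ℝ) (f t) (iteratedDeriv n (φ.scaled ε) (x - t))|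
      ≤ ∫ t, M * |iteratedDeriv n (φ.scaled ε) (x - t)| := by
        have hg : Integrable (fun t => M * |iteratedDeriv n (φ.scaled ε) (x - t)|) :=
          (hint.comp_sub_left x).abs.const_mul M
        have hle : ∀ t, ‖(ContinuousLinearMap.mul ℝ ℝ) (f t)
            (iteratedDeriv n (φ.scaled ε) (x - t))‖ ≤
            M * |iteratedDeriv n (φ.scaled ε) (x - t)| := fun t => by
          rw [ContinuousLinearMap.mul_apply', norm_mul, Real.norm_eq_abs, Real.norm_eq_abs]
          exact mul_le_mul_of_nonneg_right (hM t) (abs_nonneg _)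
        exact norm_integral_le_of_norm_le hg (Eventually.of_forall hle)
    _ = _ := by rw [integral_const_mul, h1]; ring

/-- The Heaviside function. -/
def heaviside (t : ℝ) : ℝ := if 0 ≤ t then 1 else 0

/-- The propagation speed `c(t) = c₀ + (c₁ - c₀) H(t - 1)`. -/
def speed (c₀ c₁ t : ℝ) : ℝ := c₀ + (c₁ - c₀) * heaviside (t - 1)

theorem measurable_speed (c₀ c₁ : ℝ) : Measurable (speed c₀ c₁) := by
  have h : Measurable heaviside := Measurable.ite measurableSet_Ici measurable_const measurable_const
  exact measurable_const.add (measurable_const.mul (h.comp (measurable_id.sub_const 1)))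

theorem abs_speed_le (c₀ c₁ t : ℝ) : |speed c₀ c₁ t| ≤ |c₀| + |c₁| := by
  unfold speed heaviside
  split_ifs
  · simp
  · simp

theorem locallyIntegrable_speed (c₀ c₁ : ℝ) : LocallyIntegrable (speed c₀ c₁) :=
  (locallyIntegrable_const (|c₀| + |c₁|)).mono (measurable_speed c₀ c₁).aestronglyMeasurable
    (Eventually.of_forall fun t => by
      rw [Real.norm_eq_abs, Real.norm_eq_abs, abs_of_nonneg (a := |c₀| + |c₁|) (by positivity)]
      exact abs_speed_le c₀ c₁ t)

/-- The generalized coefficient, the class of `(t, x) ↦ (c ∗ φ_ε)(t)` in `𝒢([0,∞) × ℝ)`. -/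
def Mollifier.coefficient (φ : Mollifier) (c₀ c₁ : ℝ) : GenFun halfPlane :=
  GenFun.mk (fun ε z => φ.regularize (speed c₀ c₁) ε z.1)
    ((φ.isModerate_regularize (locallyIntegrable_speed c₀ c₁) _ (abs_speed_le c₀ c₁)).comp
      (ContinuousLinearMap.fst ℝ ℝ ℝ) uniqueDiffOn_univ (subset_univ _))

end Colombeau

end

namespace Colombeau

theorem abs_sub_le_sub_of_abs_deriv_le {g g' B B' : ℝ → ℝ} {a b : ℝ} (hab : a ≤ b)
    (hg : ContinuousOn g (Icc a b)) (hg' : ∀ s ∈ Ioo a b, HasDerivAt g (g' s) s)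
    (hB : ContinuousOn B (Icc a b)) (hB' : ∀ s ∈ Ioo a b, HasDerivAt B (B' s) s)
    (h : ∀ s ∈ Ioo a b, |g' s| ≤ B' s) : |g b - g a| ≤ B b - B a := by
  have key : ∀ G G' : ℝ → ℝ, ContinuousOn G (Icc a b) → (∀ s ∈ Ioo a b, HasDerivAt G (G' s) s) →
      (∀ s ∈ Ioo a b, 0 ≤ G' s) → G a ≤ G b := by
    intro G G' hG hG' hpos
    refine monotoneOn_of_deriv_nonneg (convex_Icc a b) hG ?_ ?_ (left_mem_Icc.2 hab)
      (right_mem_Icc.2 hab) hab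
    · rw [interior_Icc]
      exact fun s hs => (hG' s hs).differentiableAt.differentiableWithinAt
    · rw [interior_Icc]
      exact fun s hs => by rw [(hG' s hs).deriv]; exact hpos s hs
  have h1 := key (fun s => B s - g s) (fun s => B' s - g' s) (hB.sub hg)
    (fun s hs => (hB' s hs).sub (hg' s hs)) fun s hs => by linarith [(abs_le.1 (h s hs)).2]
  have h2 := key (fun s => B s + g s) (fun s => B' s + g' s) (hB.add hg)
    (fun s hs => (hB' s hs).add (hg' s hs)) fun s hs => by linarith [(abs_le.1 (h s hs)).1]
  rw [abs_le]
  constructor <;> linarith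

/-- The system `∂_t w = ∂_x v`, `∂_t v = c(t)² ∂_x w + f` on the half plane satisfied by
`v = ∂_t u`, `w = ∂_x u` for a solution `u` of `∂_t² u - c(t)² ∂_x² u = f`. -/
structure WaveSystem (c c' : ℝ → ℝ) (v w f : ℝ × ℝ → ℝ) : Prop where
  hasDerivAt_speed : ∀ t, HasDerivAt c (c' t) t
  continuousOn_v : ContinuousOn v (Ici 0 ×ˢ univ)
  continuousOn_w : ContinuousOn w (Ici 0 ×ˢ univ)
  continuousOn_f : ContinuousOn f (Ici 0 ×ˢ univ)
  differentiableAt_v : ∀ z : ℝ × ℝ, 0 < z.1 → DifferentiableAt ℝ v z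
  differentiableAt_w : ∀ z : ℝ × ℝ, 0 < z.1 → DifferentiableAt ℝ w z
  symm : ∀ z : ℝ × ℝ, 0 < z.1 → fderiv ℝ w z (1, 0) = fderiv ℝ v z (0, 1)
  wave : ∀ z : ℝ × ℝ, 0 < z.1 → fderiv ℝ v z (1, 0) = c z.1 ^ 2 * fderiv ℝ w z (0, 1) + f z

namespace WaveSystem

variable {c c' : ℝ → ℝ} {v w f : ℝ × ℝ → ℝ}

theorem continuous_speed (S : WaveSystem c c' v w f) : Continuous c :=
  continuous_iff_continuousAt.2 fun t => (S.hasDerivAt_speed t).continuousAt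

theorem hasDerivAt_curve {g : ℝ × ℝ → ℝ} {γ : ℝ → ℝ} {γ' s : ℝ}
    (hg : DifferentiableAt ℝ g (s, γ s)) (hγ : HasDerivAt γ γ' s) :
    HasDerivAt (fun r => g (r, γ r))
      (fderiv ℝ g (s, γ s) (1, 0) + γ' * fderiv ℝ g (s, γ s) (0, 1)) s := by
  have h1 : HasDerivAt (fun r => (r, γ r)) ((1 : ℝ), γ') s := (hasDerivAt_id s).prodMk hγ
  have h2 := hg.hasFDerivAt.comp_hasDerivAt s h1
  have h3 : ((1 : ℝ), γ') = (1, 0) + γ' • ((0 : ℝ), (1 : ℝ)) := by simp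
  rw [h3, map_add, map_smul, smul_eq_mul] at h2
  exact h2

theorem continuousOn_curve {g : ℝ × ℝ → ℝ} {γ : ℝ → ℝ} {s : Set ℝ} (hs : s ⊆ Ici 0)
    (hg : ContinuousOn g (Ici 0 ×ˢ univ)) (hγ : Continuous γ) :
    ContinuousOn (fun r => g (r, γ r)) s :=
  hg.comp (continuous_id.prodMk hγ).continuousOn fun _ hr => ⟨hs hr, mem_univ _⟩

/-- Along a characteristic of slope `σ c̄`, where the speed is the constant `c̄`, the Riemann
invariant `v - σ c̄ w` changes by at most the integral of the forcing. -/
theorem transport (S : WaveSystem c c' v w f) {σ a t₁ t₂ x N : ℝ} (hσ : σ ^ 2 = 1) (h0 : 0 ≤ t₁)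
    (h12 : t₁ ≤ t₂) (hc : ∀ t ∈ Ioo t₁ t₂, c t = a)
    (hf : ∀ t ∈ Ioo t₁ t₂, |f (t, x + σ * a * (t - t₂))| ≤ N) :
    |(v (t₂, x) - σ * a * w (t₂, x)) -
      (v (t₁, x + σ * a * (t₁ - t₂)) - σ * a * w (t₁, x + σ * a * (t₁ - t₂)))| ≤
      N * (t₂ - t₁) := by
  set γ : ℝ → ℝ := fun t => x + σ * a * (t - t₂) with hγ
  have hγc : Continuous γ := by fun_prop
  have hγd : ∀ t, HasDerivAt γ (σ * a) t := fun t => by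
    have h := (((hasDerivAt_id t).sub_const t₂).const_mul (σ * a)).const_add x
    rw [mul_one] at h
    exact h
  have hsub : Icc t₁ t₂ ⊆ Ici 0 := fun t ht => h0.trans ht.1
  have h := abs_sub_le_sub_of_abs_deriv_le (g := fun t => v (t, γ t) - σ * a * w (t, γ t))
    (g' := fun t => f (t, γ t)) (B := fun t => N * t) (B' := fun _ => N) h12
    ((continuousOn_curve hsub S.continuousOn_v hγc).sub
      (continuousOn_const.mul (continuousOn_curve hsub S.continuousOn_w hγc)))
    (fun t ht => by
      have hpos : 0 < t := h0.trans_lt ht.1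
      have h1 := (hasDerivAt_curve (S.differentiableAt_v (t, γ t) hpos) (hγd t)).sub
        ((hasDerivAt_curve (S.differentiableAt_w (t, γ t) hpos) (hγd t)).const_mul (σ * a))
      refine h1.congr_deriv ?_
      rw [S.wave _ hpos, S.symm _ hpos]
      simp only [hc t ht]
      linear_combination (-(a ^ 2 * fderiv ℝ w (t, γ t) (0, 1))) * hσ)
    (by fun_prop) (fun t _ => by simpa using (hasDerivAt_id t).const_mul N) hf
  have e : γ t₂ = x := by simp [hγ]
  simp only [e] at h
  exact h.trans (le_of_eq (by ring))

/-- The derivative of a Riemann invariant along its characteristic. -/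
theorem hasDerivAt_riemann (S : WaveSystem c c' v w f) {σ t : ℝ} (hσ : σ ^ 2 = 1) {γ : ℝ → ℝ}
    (hγ : HasDerivAt γ (σ * c t) t) (ht : 0 < t) :
    HasDerivAt (fun s => v (s, γ s) - σ * c s * w (s, γ s))
      (f (t, γ t) - σ * c' t * w (t, γ t)) t := by
  have h1 := (hasDerivAt_curve (S.differentiableAt_v (t, γ t) ht) hγ).sub
    (((S.hasDerivAt_speed t).const_mul σ).mul
      (hasDerivAt_curve (S.differentiableAt_w (t, γ t) ht) hγ))
  refine h1.congr_deriv ?_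
  rw [S.wave _ ht, S.symm _ ht]
  linear_combination (-(c t ^ 2 * fderiv ℝ w (t, γ t) (0, 1))) * hσ

theorem abs_w_le {k a m v w : ℝ} (hk : 0 < k) (hka : k ≤ a) (hp : |v - a * w| ≤ m)
    (hq : |v + a * w| ≤ m) : |w| ≤ m / k := by
  rw [le_div_iff₀ hk]
  have h1 : |a * w| ≤ m := by
    rw [abs_le] at *
    constructor <;> linarith
  rw [abs_mul, abs_of_pos (hk.trans_le hka)] at h1
  nlinarith [abs_nonneg w]

theorem abs_v_le {a m v w : ℝ} (hp : |v - a * w| ≤ m) (hq : |v + a * w| ≤ m) : |v| ≤ m := by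
  rw [abs_le] at *
  constructor <;> linarith

/-- Sup norm estimate for the Riemann invariants on a truncated backward cone. -/
theorem cone_bound (S : WaveSystem c c' v w f) {k κ A N m t₁ t₂ x₀ R : ℝ} (hk : 0 < k)
    (hck : ∀ t, k ≤ c t) (hcκ : ∀ t, c t ≤ κ) (hA : 0 ≤ A) (h0 : 0 ≤ t₁) (hN : 0 ≤ N)
    (hc' : ∀ t ∈ Icc t₁ t₂, |c' t| ≤ A)
    (hf : ∀ t ∈ Icc t₁ t₂, ∀ x, |x - x₀| ≤ R → |f (t, x)| ≤ N)
    (hp : ∀ x, |x - x₀| ≤ R → |v (t₁, x) - c t₁ * w (t₁, x)| < m)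
    (hq : ∀ x, |x - x₀| ≤ R → |v (t₁, x) + c t₁ * w (t₁, x)| < m)
    {t x : ℝ} (ht : t ∈ Icc t₁ t₂) (hx : |x - x₀| ≤ R - κ * (t - t₁)) :
    |v (t, x) - c t * w (t, x)| ≤ (m + N * (t - t₁)) * Real.exp (A / k * (t - t₁)) ∧
      |v (t, x) + c t * w (t, x)| ≤ (m + N * (t - t₁)) * Real.exp (A / k * (t - t₁)) := by
  have hκ : 0 < κ := hk.trans_le ((hck 0).trans (hcκ 0))
  set L := A / k with hL
  have hL0 : 0 ≤ L := div_nonneg hA hk.le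
  set B : ℝ → ℝ := fun t => (m + N * (t - t₁)) * Real.exp (L * (t - t₁)) with hB
  set B' : ℝ → ℝ := fun t => N * Real.exp (L * (t - t₁)) + L * B t with hB'
  have hBd : ∀ t, HasDerivAt B (B' t) t := fun t => by
    have h1 : HasDerivAt (fun t => m + N * (t - t₁)) N t := by
      simpa using (((hasDerivAt_id t).sub_const t₁).const_mul N).const_add m
    have h2 : HasDerivAt (fun t => L * (t - t₁)) L t := by
      simpa using ((hasDerivAt_id t).sub_const t₁).const_mul L
    refine (h1.mul h2.exp).congr_deriv ?_
    simp only [hB', hB]; ring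
  have hBc : Continuous B := by fun_prop
  have hcc := S.continuous_speed
  set P : ℝ → ℝ × ℝ → ℝ := fun σ z => v z - σ * c z.1 * w z with hP
  have hPc : ∀ σ, ContinuousOn (P σ) (Ici 0 ×ˢ univ) := fun σ =>
    S.continuousOn_v.sub ((continuous_const.mul (hcc.comp continuous_fst)).continuousOn.mul
      S.continuousOn_w)
  set K : Set (ℝ × ℝ) := {z | z.1 ∈ Icc t₁ t₂ ∧ |z.2 - x₀| ≤ R - κ * (z.1 - t₁)} with hK
  have hKc : IsCompact K := by
    have hcl : IsClosed {z : ℝ × ℝ | |z.2 - x₀| ≤ R - κ * (z.1 - t₁)} :=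
      isClosed_le (by fun_prop) (by fun_prop)
    refine ((isCompact_Icc (a := t₁) (b := t₂)).prod (isCompact_Icc (a := x₀ - R) (b := x₀ + R))).of_isClosed_subset
      ((isClosed_Icc.preimage continuous_fst).inter hcl) ?_
    rintro z ⟨hz1, hz2⟩
    have h3 : 0 ≤ κ * (z.1 - t₁) := mul_nonneg hκ.le (by linarith [hz1.1])
    refine ⟨hz1, ?_⟩
    rw [abs_le] at hz2
    constructor <;> linarith
  have hKH : K ⊆ Ici 0 ×ˢ univ := fun z hz => ⟨h0.trans hz.1.1, mem_univ _⟩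
  suffices hgoal : ∀ z ∈ K, |P 1 z| < B z.1 ∧ |P (-1) z| < B z.1 by
    have h1 := hgoal (t, x) ⟨ht, hx⟩
    refine ⟨by simpa [hP] using h1.1.le, by simpa [hP] using h1.2.le⟩
  by_contra hcon
  push Not at hcon
  set Z : Set (ℝ × ℝ) := {z ∈ K | B z.1 ≤ max |P 1 z| |P (-1) z|} with hZ
  have hZc : IsCompact Z := by
    have h1 : ContinuousOn (fun z => max |P 1 z| |P (-1) z| - B z.1) K :=
      ((((hPc 1).mono hKH).abs).sup (((hPc (-1)).mono hKH).abs)).sub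
        (hBc.comp continuous_fst).continuousOn
    have h2 : Z = K ∩ (fun z => max |P 1 z| |P (-1) z| - B z.1) ⁻¹' Ici 0 := by
      ext z
      simp only [hZ, mem_ofPred_eq, mem_inter_iff, mem_preimage, mem_Ici, sub_nonneg]
    rw [h2]
    exact hKc.of_isClosed_subset (h1.preimage_isClosed_of_isClosed hKc.isClosed isClosed_Ici)
      inter_subset_left
  have hZne : Z.Nonempty := by
    obtain ⟨z, hzK, hz⟩ := hcon
    refine ⟨z, hzK, ?_⟩
    by_cases h1 : |P 1 z| < B z.1
    · exact le_max_of_le_right (hz h1)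
    · exact le_max_of_le_left (not_lt.1 h1)
  obtain ⟨z, hz, hmin⟩ := hZc.exists_isMinOn hZne continuous_fst.continuousOn
  have hlt : ∀ y ∈ K, y.1 < z.1 → |P 1 y| < B y.1 ∧ |P (-1) y| < B y.1 := by
    intro y hy hyz
    by_contra h1
    have h2 : y ∈ Z := by
      refine ⟨hy, ?_⟩
      rw [not_and_or, not_lt, not_lt] at h1
      exact le_max_iff.2 h1
    exact absurd (hmin h2) (not_le.2 hyz)
  obtain ⟨s, y⟩ := z
  obtain ⟨⟨hs, hy⟩, hzB⟩ := hz
  simp only at hs hy hzB hlt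
  obtain ⟨σ, hσ, hσB⟩ : ∃ σ : ℝ, (σ = 1 ∨ σ = -1) ∧ B s ≤ |P σ (s, y)| := by
    rcases le_max_iff.1 hzB with h | h
    · exact ⟨1, .inl rfl, h⟩
    · exact ⟨-1, .inr rfl, h⟩
  have hσ2 : σ ^ 2 = 1 := by rcases hσ with rfl | rfl <;> norm_num
  have hσa : |σ| = 1 := by rcases hσ with rfl | rfl <;> simp
  set γ : ℝ → ℝ := fun r => y + σ * ∫ q in s..r, c q with hγ
  have hγd : ∀ r, HasDerivAt γ (σ * c r) r := fun r =>
    (((intervalIntegral.integral_hasDerivAt_right (hcc.intervalIntegrable _ _)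
      (hcc.stronglyMeasurableAtFilter _ _) hcc.continuousAt)).const_mul σ).const_add y
  have hγc : Continuous γ := continuous_iff_continuousAt.2 fun r => (hγd r).continuousAt
  have hγs : γ s = y := by simp [hγ]
  have hγK : ∀ r ∈ Icc t₁ s, (r, γ r) ∈ K := by
    intro r hr
    refine ⟨⟨hr.1, hr.2.trans hs.2⟩, ?_⟩
    have h1 : |∫ q in s..r, c q| ≤ κ * (s - r) := by
      have h2 := intervalIntegral.norm_integral_le_of_norm_le_const (a := s) (b := r) (f := c)
        (C := κ) fun q _ => by
          rw [Real.norm_eq_abs, abs_of_pos (hk.trans_le (hck q))]; exact hcκ q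
      rwa [Real.norm_eq_abs, abs_sub_comm, abs_of_nonneg (sub_nonneg.2 hr.2)] at h2
    calc |γ r - x₀| = |(y - x₀) + σ * ∫ q in s..r, c q| := by simp only [hγ]; congr 1; ring
      _ ≤ |y - x₀| + |σ * ∫ q in s..r, c q| := abs_add_le _ _
      _ = |y - x₀| + |∫ q in s..r, c q| := by rw [abs_mul, hσa, one_mul]
      _ ≤ (R - κ * (s - t₁)) + κ * (s - r) := add_le_add hy h1
      _ = _ := by ring
  have hcmp := abs_sub_le_sub_of_abs_deriv_le (g := fun r => P σ (r, γ r))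
    (g' := fun r => f (r, γ r) - σ * c' r * w (r, γ r)) (B := B) (B' := B') hs.1
    ((hPc σ).comp (continuous_id.prodMk hγc).continuousOn fun r hr => hKH (hγK r hr))
    (fun r hr => S.hasDerivAt_riemann hσ2 (hγd r) (h0.trans_lt hr.1)) hBc.continuousOn
    (fun r _ => hBd r) (fun r hr => by
      have hrI : r ∈ Icc t₁ s := ⟨hr.1.le, hr.2.le⟩
      have hrK := hγK r hrI
      have hb := hlt _ hrK hr.2
      have hw : |w (r, γ r)| ≤ B r / k := by
        refine abs_w_le (v := v (r, γ r)) hk (hck r) ?_ ?_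
        · simpa [hP] using hb.1.le
        · simpa [hP] using hb.2.le
      have hBr : 0 ≤ B r := (abs_nonneg _).trans hb.1.le
      have hR : |γ r - x₀| ≤ R := hrK.2.trans (by
        have : 0 ≤ κ * (r - t₁) := mul_nonneg hκ.le (by linarith [hr.1])
        simp only; linarith)
      have h1 : |σ * c' r * w (r, γ r)| ≤ L * B r := by
        rw [abs_mul, abs_mul, hσa, one_mul]
        calc _ ≤ A * (B r / k) := mul_le_mul (hc' r hrK.1) hw (abs_nonneg _) hA
          _ = _ := by rw [hL]; ring
      have h2 : 1 ≤ Real.exp (L * (r - t₁)) :=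
        Real.one_le_exp (mul_nonneg hL0 (by linarith [hr.1]))
      calc _ ≤ |f (r, γ r)| + |σ * c' r * w (r, γ r)| := abs_sub _ _
        _ ≤ N + L * B r := add_le_add (hf r hrK.1 _ hR) h1
        _ ≤ B' r := by simp only [hB']; nlinarith)
  have hinit : |P σ (t₁, γ t₁)| < B t₁ := by
    have h1 := (hγK t₁ ⟨le_rfl, hs.1⟩).2
    simp only [sub_self, mul_zero, sub_zero] at h1
    have h2 : B t₁ = m := by simp [hB]
    rw [h2]
    rcases hσ with rfl | rfl
    · simpa [hP] using hp _ h1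
    · simpa [hP] using hq _ h1
  simp only [hγs] at hcmp
  have h3 := abs_sub_abs_le_abs_sub (P σ (s, y)) (P σ (t₁, γ t₁))
  linarith

end WaveSystem
end Colombeau

namespace Colombeau

theorem WaveSystem.continuousOn_slice {g : ℝ × ℝ → ℝ} (hg : ContinuousOn g (Ici 0 ×ˢ univ)) {t : ℝ}
    (ht : 0 ≤ t) : Continuous fun x => g (t, x) :=
  hg.comp_continuous (by fun_prop) fun _ => ⟨ht, mem_univ _⟩

/-- Divergence theorem on a rectangle, in the form of a balance law. -/
theorem abs_balance_le {F G f : ℝ × ℝ → ℝ} {t₁ t₂ a b N m : ℝ} (h0 : 0 ≤ t₁) (h12 : t₁ ≤ t₂)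
    (hab : a ≤ b) (hF : ContinuousOn F (Ici 0 ×ˢ univ)) (hG : ContinuousOn G (Ici 0 ×ˢ univ))
    (hf : ContinuousOn f (Ici 0 ×ˢ univ))
    (hFd : ∀ z : ℝ × ℝ, 0 < z.1 → DifferentiableAt ℝ F z)
    (hGd : ∀ z : ℝ × ℝ, 0 < z.1 → DifferentiableAt ℝ G z)
    (heq : ∀ z : ℝ × ℝ, 0 < z.1 → fderiv ℝ F z (1, 0) = fderiv ℝ G z (0, 1) + f z)
    (hfN : ∀ t ∈ Icc t₁ t₂, ∀ x ∈ Icc a b, |f (t, x)| ≤ N)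
    (hGa : ∀ t ∈ Icc t₁ t₂, |G (t, a)| ≤ m) (hGb : ∀ t ∈ Icc t₁ t₂, |G (t, b)| ≤ m) :
    |(∫ x in a..b, F (t₂, x)) - ∫ x in a..b, F (t₁, x)| ≤ (2 * m + N * (b - a)) * (t₂ - t₁) := by
  have hsub : Icc t₁ t₂ ×ˢ Icc a b ⊆ Ici 0 ×ˢ univ :=
    prod_mono (fun t ht => h0.trans ht.1) (subset_univ _)
  have hpos : ∀ z ∈ Ioo t₁ t₂ ×ˢ Ioo a b, 0 < z.1 := fun z hz => h0.trans_lt hz.1.1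
  have hdiv : ∀ z ∈ Ioo t₁ t₂ ×ˢ Ioo a b,
      fderiv ℝ F z (1, 0) + (fderiv ℝ (-G) z) (0, 1) = f z := fun z hz => by
    rw [fderiv_neg, heq z (hpos z hz)]; simp
  have hae : (fun z => fderiv ℝ F z (1, 0) + (fderiv ℝ (-G) z) (0, 1)) =ᵐ[volume.restrict
      (Icc t₁ t₂ ×ˢ Icc a b)] f := by
    have h1 : (Ioo t₁ t₂ ×ˢ Ioo a b : Set (ℝ × ℝ)) =ᵐ[volume] Icc t₁ t₂ ×ˢ Icc a b :=
      Measure.set_prod_ae_eq Ioo_ae_eq_Icc Ioo_ae_eq_Icc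
    rw [← Measure.restrict_congr_set h1]
    exact (ae_restrict_iff' (measurableSet_Ioo.prod measurableSet_Ioo)).2
      (Eventually.of_forall hdiv)
  have hfi : IntegrableOn f (Icc t₁ t₂ ×ˢ Icc a b) :=
    (hf.mono hsub).integrableOn_compact (isCompact_Icc.prod isCompact_Icc)
  have key := integral2_divergence_prod_of_hasFDerivAt F (-G) (fun z => fderiv ℝ F z)
    (fun z => fderiv ℝ (-G) z) t₁ a t₂ b
    (by rw [uIcc_of_le h12, uIcc_of_le hab]; exact hF.mono hsub)
    (by rw [uIcc_of_le h12, uIcc_of_le hab]; exact (hG.mono hsub).neg)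
    (by rw [min_eq_left h12, max_eq_right h12, min_eq_left hab, max_eq_right hab]
        exact fun z hz => (hFd z (hpos z hz)).hasFDerivAt)
    (by rw [min_eq_left h12, max_eq_right h12, min_eq_left hab, max_eq_right hab]
        exact fun z hz => (hGd z (hpos z hz)).neg.hasFDerivAt)
    (by rw [uIcc_of_le h12, uIcc_of_le hab]; exact hfi.congr_fun_ae hae.symm)
  have hI : (∫ t in t₁..t₂, ∫ x in a..b,
      fderiv ℝ F (t, x) (1, 0) + fderiv ℝ (-G) (t, x) (0, 1)) =
      ∫ t in t₁..t₂, ∫ x in a..b, f (t, x) := by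
    rw [intervalIntegral.integral_of_le h12, intervalIntegral.integral_of_le h12,
      integral_Ioc_eq_integral_Ioo, integral_Ioc_eq_integral_Ioo]
    refine setIntegral_congr_fun measurableSet_Ioo fun t ht => ?_
    rw [intervalIntegral.integral_of_le hab, intervalIntegral.integral_of_le hab,
      integral_Ioc_eq_integral_Ioo, integral_Ioc_eq_integral_Ioo]
    exact setIntegral_congr_fun measurableSet_Ioo fun x hx => hdiv (t, x) ⟨ht, hx⟩
  rw [hI] at key
  have h1 : |∫ t in t₁..t₂, ∫ x in a..b, f (t, x)| ≤ N * (b - a) * (t₂ - t₁) := by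
    have := intervalIntegral.norm_integral_le_of_norm_le_const (a := t₁) (b := t₂)
      (f := fun t => ∫ x in a..b, f (t, x)) (C := N * (b - a)) fun t ht => by
        rw [uIoc_of_le h12] at ht
        have h2 := intervalIntegral.norm_integral_le_of_norm_le_const (a := a) (b := b)
          (f := fun x => f (t, x)) (C := N) fun x hx => by
            rw [uIoc_of_le hab] at hx
            exact hfN t ⟨ht.1.le, ht.2⟩ x ⟨hx.1.le, hx.2⟩
        rwa [abs_of_nonneg (sub_nonneg.2 hab)] at h2
    rwa [abs_of_nonneg (sub_nonneg.2 h12)] at this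
  have h2 : ∀ y, (∀ t ∈ Icc t₁ t₂, |G (t, y)| ≤ m) →
      |∫ t in t₁..t₂, (-G) (t, y)| ≤ m * (t₂ - t₁) := fun y hy => by
    have := intervalIntegral.norm_integral_le_of_norm_le_const (a := t₁) (b := t₂)
      (f := fun t => (-G) (t, y)) (C := m) fun t ht => by
        rw [uIoc_of_le h12] at ht
        simpa using hy t ⟨ht.1.le, ht.2⟩
    rwa [abs_of_nonneg (sub_nonneg.2 h12)] at this
  have h3 := abs_le.1 (h2 a hGa)
  have h4 := abs_le.1 (h2 b hGb)
  have h5 := abs_le.1 h1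
  rw [abs_le]
  constructor <;> linarith

/-- A wave system at a single scale `ε`: the speed passes from `c₀` to `c₁` during
`[1 - ε, 1 + ε]`, the forcing and the initial errors are bounded by `N`, and the initial velocity
is the approximate delta `g`. -/
structure Scattering (c₀ c₁ k κ M T X ε N : ℝ) (g c c' : ℝ → ℝ) (v w f : ℝ × ℝ → ℝ) : Prop
    extends WaveSystem c c' v w f where
  k_pos : 0 < k
  le_speed : ∀ t, k ≤ c t
  speed_le : ∀ t, c t ≤ κ
  eps_pos : 0 < ε
  eps_le : ε ≤ 1
  speed_left : ∀ t ≤ 1 - ε, c t = c₀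
  speed_right : ∀ t, 1 + ε ≤ t → c t = c₁
  M_nonneg : 0 ≤ M
  deriv_le : ∀ t, |c' t| ≤ M / ε
  two_le : 2 ≤ T
  N_pos : 0 < N
  forcing : ∀ t ∈ Icc 0 T, ∀ x, |x| ≤ X → |f (t, x)| ≤ N
  init_v : ∀ x, |x| ≤ X → |v (0, x) - g x| ≤ N
  init_w : ∀ x, |x| ≤ X → |w (0, x)| ≤ N
  continuous_init : Continuous g
  init_eq_zero : ∀ x, ε < |x| → g x = 0
  integral_init : ∀ a b, a ≤ -ε → ε ≤ b → ∫ x in a..b, g x = 1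

namespace Scattering

variable {c₀ c₁ k κ M T X ε N : ℝ} {g c c' : ℝ → ℝ} {v w f : ℝ × ℝ → ℝ}

theorem left_mem (S : Scattering c₀ c₁ k κ M T X ε N g c c' v w f) : 0 < c₀ ∧ k ≤ c₀ ∧ c₀ ≤ κ := by
  have h := S.speed_left (1 - ε) le_rfl
  rw [← h]
  exact ⟨S.k_pos.trans_le (S.le_speed _), S.le_speed _, S.speed_le _⟩

theorem right_mem (S : Scattering c₀ c₁ k κ M T X ε N g c c' v w f) :
    0 < c₁ ∧ k ≤ c₁ ∧ c₁ ≤ κ := by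
  have h := S.speed_right (1 + ε) le_rfl
  rw [← h]
  exact ⟨S.k_pos.trans_le (S.le_speed _), S.le_speed _, S.speed_le _⟩

theorem sq_of_sign {σ : ℝ} (hσ : σ = 1 ∨ σ = -1) : σ ^ 2 = 1 := by
  rcases hσ with rfl | rfl <;> norm_num

theorem abs_of_sign {σ : ℝ} (hσ : σ = 1 ∨ σ = -1) : |σ| = 1 := by
  rcases hσ with rfl | rfl <;> norm_num

theorem abs_sign_mul {σ a : ℝ} (hσ : σ = 1 ∨ σ = -1) : |σ * a| = |a| := by
  rw [abs_mul, abs_of_sign hσ, one_mul]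

/-- Before the transition the Riemann invariants are the translates of the initial velocity. -/
theorem before (S : Scattering c₀ c₁ k κ M T X ε N g c c' v w f) {σ t x : ℝ}
    (hσ : σ = 1 ∨ σ = -1) (ht : t ∈ Icc 0 (1 - ε)) (hx : |x| + κ ≤ X) :
    |v (t, x) - σ * c₀ * w (t, x) - g (x - σ * c₀ * t)| ≤ (2 + κ) * N := by
  obtain ⟨h0, -, hκ⟩ := S.left_mem
  have hε := S.eps_pos
  have hT := S.two_le
  have hN := S.N_pos
  have hb : ∀ s ∈ Icc 0 t, |x + σ * c₀ * (s - t)| ≤ X := by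
    intro s hs
    have h1 : |σ * c₀ * (s - t)| ≤ κ := by
      rw [mul_assoc, abs_sign_mul hσ, abs_mul, abs_of_pos h0, abs_sub_comm,
        abs_of_nonneg (sub_nonneg.2 hs.2)]
      nlinarith [ht.2, hs.1, hs.2]
    exact (abs_add_le _ _).trans (by linarith)
  have h1 := S.transport (x := x) (N := N) (sq_of_sign hσ) le_rfl ht.1
    (fun s hs => S.speed_left s (hs.2.le.trans ht.2))
    (fun s hs => S.forcing s ⟨hs.1.le, by linarith [hs.2, ht.2]⟩ _ (hb s ⟨hs.1.le, hs.2.le⟩))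
  have hx0 := hb 0 ⟨le_rfl, ht.1⟩
  have e : x + σ * c₀ * (0 - t) = x - σ * c₀ * t := by ring
  rw [e] at h1 hx0
  have h2 := S.init_v _ hx0
  have h3 : |σ * c₀ * w (0, x - σ * c₀ * t)| ≤ κ * N := by
    rw [mul_assoc, abs_sign_mul hσ, abs_mul, abs_of_pos h0]
    exact mul_le_mul hκ (S.init_w _ hx0) (abs_nonneg _) (h0.le.trans hκ)
  have h4 : N * (t - 0) ≤ N := by nlinarith [ht.2]
  rw [abs_le] at *
  constructor <;> linarith

theorem before_small (S : Scattering c₀ c₁ k κ M T X ε N g c c' v w f) {σ t x : ℝ}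
    (hσ : σ = 1 ∨ σ = -1) (ht : t ∈ Icc 0 (1 - ε)) (hx : |x| + κ ≤ X)
    (hd : ε < |x - σ * c₀ * t|) : |v (t, x) - σ * c₀ * w (t, x)| ≤ (2 + κ) * N := by
  have h := S.before hσ ht hx
  rwa [S.init_eq_zero _ hd, sub_zero] at h

/-- The amplification constant of the transition. -/
noncomputable def amp (k κ M : ℝ) : ℝ := (5 + κ) * Real.exp (2 * M / k)

theorem le_amp (S : Scattering c₀ c₁ k κ M T X ε N g c c' v w f) : 5 + κ ≤ amp k κ M := by
  have h1 : 1 ≤ Real.exp (2 * M / k) :=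
    Real.one_le_exp (div_nonneg (by linarith [S.M_nonneg]) S.k_pos.le)
  have h2 : 0 < κ := S.left_mem.1.trans_le S.left_mem.2.2
  unfold amp
  nlinarith

theorem during_small (S : Scattering c₀ c₁ k κ M T X ε N g c c' v w f) {σ t x : ℝ}
    (hσ : σ = 1 ∨ σ = -1) (ht : t ∈ Icc (1 - ε) (1 + ε)) (hx : |x| + 4 * κ ≤ X)
    (hd : ∀ τ : ℝ, τ = 1 ∨ τ = -1 → (1 + 3 * κ) * ε < |x - τ * c₀|) :
    |v (t, x) - σ * c t * w (t, x)| ≤ amp k κ M * N := by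
  obtain ⟨h0, -, hκ⟩ := S.left_mem
  have hε := S.eps_pos
  have hε1 := S.eps_le
  have hT := S.two_le
  have hN := S.N_pos
  have hM := S.M_nonneg
  have hk := S.k_pos
  have hκ0 : 0 < κ := h0.trans_le hκ
  have hball : ∀ y, |y - x| ≤ 2 * κ * ε → |y| ≤ |x| + 2 * κ := fun y hy => by
    have h1 := abs_sub_abs_le_abs_sub y x
    nlinarith
  have hinit : ∀ τ : ℝ, τ = 1 ∨ τ = -1 → ∀ y, |y - x| ≤ 2 * κ * ε →
      |v (1 - ε, y) - τ * c₀ * w (1 - ε, y)| < (3 + κ) * N := by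
    intro τ hτ y hy
    have hy2 := hball y hy
    refine (S.before_small hτ ⟨by linarith, le_rfl⟩ (by linarith) ?_).trans_lt (by linarith)
    have h1 : x - τ * c₀ = (y - τ * c₀ * (1 - ε)) - (y - x) - τ * (c₀ * ε) := by ring
    have h2 := hd τ hτ
    rw [h1] at h2
    have h3 := abs_sub (y - τ * c₀ * (1 - ε) - (y - x)) (τ * (c₀ * ε))
    have h4 := abs_sub (y - τ * c₀ * (1 - ε)) (y - x)
    rw [abs_sign_mul hτ, abs_of_nonneg (mul_nonneg h0.le hε.le)] at h3
    nlinarith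
  have hct : c (1 - ε) = c₀ := S.speed_left _ le_rfl
  have h := S.cone_bound (t₁ := 1 - ε) (t₂ := 1 + ε) (x₀ := x) (R := 2 * κ * ε) (A := M / ε)
    (N := N) (m := (3 + κ) * N) (t := t) (x := x) hk S.le_speed S.speed_le (by positivity)
    (by linarith) hN.le (fun t _ => S.deriv_le t)
    (fun s hs y hy => S.forcing s ⟨by linarith [hs.1], by linarith [hs.2]⟩ y
      (by linarith [hball y hy]))
    (fun y hy => by simpa [hct] using hinit 1 (.inl rfl) y hy)
    (fun y hy => by simpa [hct] using hinit (-1) (.inr rfl) y hy) ht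
    (by rw [sub_self, abs_zero]; nlinarith [ht.2])
  have hfac : ((3 + κ) * N + N * (t - (1 - ε))) * Real.exp (M / ε / k * (t - (1 - ε))) ≤
      amp k κ M * N := by
    have h1 : M / ε / k * (t - (1 - ε)) ≤ 2 * M / k := by
      rw [div_div, div_mul_eq_mul_div, div_le_div_iff₀ (by positivity) hk]
      have : M * (t - (1 - ε)) ≤ M * (2 * ε) := mul_le_mul_of_nonneg_left (by linarith [ht.2]) hM
      nlinarith
    have h2 : (3 + κ) * N + N * (t - (1 - ε)) ≤ (5 + κ) * N := by nlinarith [ht.2]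
    calc _ ≤ (5 + κ) * N * Real.exp (2 * M / k) :=
          mul_le_mul h2 (Real.exp_le_exp.2 h1) (Real.exp_pos _).le (by positivity)
      _ = _ := by unfold amp; ring
  rcases hσ with rfl | rfl
  · simpa using h.1.trans hfac
  · simpa using h.2.trans hfac

/-- After the transition the Riemann invariants are transported with speed `c₁`. -/
theorem after (S : Scattering c₀ c₁ k κ M T X ε N g c c' v w f) {σ t x : ℝ}
    (hσ : σ = 1 ∨ σ = -1) (ht : t ∈ Icc (1 + ε) T) (hx : |x| + κ * T ≤ X) :
    |(v (t, x) - σ * c₁ * w (t, x)) - (v (1 + ε, x + σ * c₁ * (1 + ε - t)) -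
      σ * c₁ * w (1 + ε, x + σ * c₁ * (1 + ε - t)))| ≤ T * N := by
  obtain ⟨h0, -, hκ⟩ := S.right_mem
  have hε := S.eps_pos
  have hN := S.N_pos
  have h1 := S.transport (x := x) (N := N) (sq_of_sign hσ) (by linarith) ht.1
    (fun s hs => S.speed_right s hs.1.le)
    (fun s hs => S.forcing s ⟨by linarith [hs.1], by linarith [hs.2, ht.2]⟩ _ (by
      refine (abs_add_le _ _).trans ?_
      rw [mul_assoc, abs_sign_mul hσ, abs_mul, abs_of_pos h0, abs_sub_comm,
        abs_of_nonneg (sub_nonneg.2 hs.2.le)]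
      have : c₁ * (t - s) ≤ κ * T :=
        mul_le_mul hκ (by linarith [hs.1, ht.2]) (by linarith [hs.2]) (h0.le.trans hκ)
      linarith))
  refine h1.trans ?_
  nlinarith [ht.2]

theorem after_small (S : Scattering c₀ c₁ k κ M T X ε N g c c' v w f) {σ t x : ℝ}
    (hσ : σ = 1 ∨ σ = -1) (ht : t ∈ Icc (1 + ε) T) (hx : |x| + κ * (T + 4) ≤ X)
    (hd : ∀ τ : ℝ, τ = 1 ∨ τ = -1 → (1 + 4 * κ) * ε < |x - σ * c₁ * (t - 1) - τ * c₀|) :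
    |v (t, x) - σ * c₁ * w (t, x)| ≤ (amp k κ M + T) * N := by
  obtain ⟨h0, -, hκ⟩ := S.right_mem
  have hε := S.eps_pos
  have hκ0 : 0 < κ := h0.trans_le hκ
  have h1 := S.after hσ ht (x := x) (by nlinarith)
  have h2 := S.during_small (t := 1 + ε) (x := x + σ * c₁ * (1 + ε - t)) hσ
    ⟨by linarith, le_rfl⟩ (by
      have : |x + σ * c₁ * (1 + ε - t)| ≤ |x| + κ * T := by
        refine (abs_add_le _ _).trans (add_le_add le_rfl ?_)
        rw [mul_assoc, abs_sign_mul hσ, abs_mul, abs_of_pos h0, abs_sub_comm,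
          abs_of_nonneg (sub_nonneg.2 ht.1)]
        exact mul_le_mul hκ (by linarith [ht.2]) (by linarith [ht.1]) hκ0.le
      nlinarith) (fun τ hτ => by
      have h3 := hd τ hτ
      have h4 : x - σ * c₁ * (t - 1) - τ * c₀ =
        (x + σ * c₁ * (1 + ε - t) - τ * c₀) - σ * (c₁ * ε) := by ring
      rw [h4] at h3
      have h5 := abs_sub (x + σ * c₁ * (1 + ε - t) - τ * c₀) (σ * (c₁ * ε))
      rw [abs_sign_mul hσ, abs_of_nonneg (mul_nonneg h0.le hε.le)] at h5
      nlinarith)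
  rw [S.speed_right _ le_rfl] at h2
  rw [abs_le] at *
  constructor <;> linarith

/-- The Riemann invariants are small away from the broken characteristics. -/
theorem small (S : Scattering c₀ c₁ k κ M T X ε N g c c' v w f) {σ t x : ℝ}
    (hσ : σ = 1 ∨ σ = -1) (ht : t ∈ Icc 0 T) (hx : |x| + κ * (T + 4) ≤ X)
    (hd : ∀ τ : ℝ, τ = 1 ∨ τ = -1 →
      (1 + 4 * κ) * ε < |x - τ * c₀ * min t 1 - σ * c₁ * max (t - 1) 0|) :
    |v (t, x) - σ * c t * w (t, x)| ≤ (amp k κ M + T) * N := by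
  obtain ⟨h0, -, hκ⟩ := S.left_mem
  obtain ⟨h1, -, hκ1⟩ := S.right_mem
  have hε := S.eps_pos
  have hN := S.N_pos
  have hT := S.two_le
  have hκ0 : 0 < κ := h1.trans_le hκ1
  have hamp := S.le_amp
  rcases le_total t (1 - ε) with h | h
  · have h2 := hd σ hσ
    rw [min_eq_left (by linarith), max_eq_right (by linarith), mul_zero, sub_zero] at h2
    rw [S.speed_left t h]
    refine (S.before_small hσ ⟨ht.1, h⟩ (by nlinarith) (by nlinarith)).trans ?_
    exact mul_le_mul_of_nonneg_right (by linarith) hN.le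
  rcases le_total t (1 + ε) with h' | h'
  · refine (S.during_small hσ ⟨h, h'⟩ (by nlinarith) fun τ hτ => ?_).trans
      (mul_le_mul_of_nonneg_right (by linarith) hN.le)
    have h2 := hd τ hτ
    rcases le_total t 1 with h3 | h3
    · rw [min_eq_left h3, max_eq_right (by linarith), mul_zero, sub_zero] at h2
      have e : x - τ * c₀ * t = (x - τ * c₀) + τ * (c₀ * (1 - t)) := by ring
      rw [e] at h2
      have h4 := abs_add_le (x - τ * c₀) (τ * (c₀ * (1 - t)))
      rw [abs_sign_mul hτ, abs_of_nonneg (mul_nonneg h0.le (by linarith))] at h4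
      have h5 : c₀ * (1 - t) ≤ κ * ε := mul_le_mul hκ (by linarith) (by linarith) hκ0.le
      linarith
    · rw [min_eq_right h3, max_eq_left (by linarith), mul_one] at h2
      have h4 := abs_sub (x - τ * c₀) (σ * c₁ * (t - 1))
      rw [mul_assoc σ, abs_sign_mul hσ, abs_of_nonneg (mul_nonneg h1.le (by linarith))] at h4
      rw [mul_assoc σ] at h2
      have h5 : c₁ * (t - 1) ≤ κ * ε := mul_le_mul hκ1 (by linarith) (by linarith) hκ0.le
      linarith
  · rw [S.speed_right t h']
    refine S.after_small hσ ⟨h', ht.2⟩ hx fun τ hτ => ?_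
    have h2 := hd τ hτ
    rw [min_eq_right (by linarith), max_eq_left (by linarith), mul_one] at h2
    rwa [sub_right_comm]

end Scattering
end Colombeau

namespace Colombeau

theorem abs_integral_sub_le {F G : ℝ → ℝ} {a b B : ℝ} (hab : a ≤ b) (hF : Continuous F)
    (hG : Continuous G) (h : ∀ x ∈ Icc a b, |F x - G x| ≤ B) :
    |(∫ x in a..b, F x) - ∫ x in a..b, G x| ≤ B * (b - a) := by
  rw [← intervalIntegral.integral_sub (hF.intervalIntegrable _ _) (hG.intervalIntegrable _ _)]
  have := intervalIntegral.norm_integral_le_of_norm_le_const (a := a) (b := b)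
    (f := fun x => F x - G x) (C := B) fun x hx => by
      rw [uIoc_of_le hab] at hx
      exact h x ⟨hx.1.le, hx.2⟩
  rwa [abs_of_nonneg (sub_nonneg.2 hab)] at this

namespace Scattering

variable {c₀ c₁ k κ M T X ε N : ℝ} {g c c' : ℝ → ℝ} {v w f : ℝ × ℝ → ℝ}

theorem continuous_riemann (S : Scattering c₀ c₁ k κ M T X ε N g c c' v w f) (a : ℝ) {t : ℝ}
    (ht : 0 ≤ t) : Continuous fun x => v (t, x) - a * w (t, x) :=
  (WaveSystem.continuousOn_slice S.continuousOn_v ht).sub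
    (continuous_const.mul (WaveSystem.continuousOn_slice S.continuousOn_w ht))

theorem integral_comp_translate (S : Scattering c₀ c₁ k κ M T X ε N g c c' v w f) {a b y : ℝ}
    (ha : a ≤ y - ε) (hb : y + ε ≤ b) : ∫ x in a..b, g (x - y) = 1 := by
  rw [intervalIntegral.integral_comp_sub_right]
  exact S.integral_init _ _ (by linarith) (by linarith)

/-- Before the transition the outgoing pulse has unit mass. -/
theorem integral_before (S : Scattering c₀ c₁ k κ M T X ε N g c c' v w f) {σ t a b : ℝ}
    (hσ : σ = 1 ∨ σ = -1) (ht : t ∈ Icc 0 (1 - ε)) (hX : ∀ x ∈ Icc a b, |x| + κ ≤ X)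
    (ha : a ≤ σ * c₀ * t - ε) (hb : σ * c₀ * t + ε ≤ b) :
    |(∫ x in a..b, (v (t, x) - σ * c₀ * w (t, x))) - 1| ≤ (2 + κ) * N * (b - a) := by
  have hε := S.eps_pos
  rw [← S.integral_comp_translate ha hb]
  exact abs_integral_sub_le (by linarith) (S.continuous_riemann _ ht.1)
    (S.continuous_init.comp (continuous_id.sub continuous_const))
    fun x hx => S.before hσ ht (hX x hx)

/-- The constant in the transmission estimate. -/
noncomputable def transErr (k κ M L : ℝ) : ℝ :=
  ((1 + κ) * L + κ * (L / k)) * (2 + κ) +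
    (2 * (amp k κ M * (1 + κ ^ 2 / k)) + (1 + κ) * L) * 2 * (1 + κ)

/-- The masses of the transmitted and of the reflected pulse at the end of the transition. -/
theorem integral_transition (S : Scattering c₀ c₁ k κ M T X ε N g c c' v w f) {σ τ a b L : ℝ}
    (hσ : σ = 1 ∨ σ = -1) (hτ : τ = 1 ∨ τ = -1) (hX : ∀ x ∈ Icc a b, |x| + 4 * κ ≤ X)
    (hL : b - a ≤ L) (hε : (1 + 3 * κ) * ε < c₀)
    (ha : a < τ * c₀ - (1 + 3 * κ) * ε) (hb : τ * c₀ + (1 + 3 * κ) * ε < b)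
    (ha' : τ * c₀ - c₀ ≤ a) (hb' : b ≤ τ * c₀ + c₀) :
    |(∫ x in a..b, (v (1 + ε, x) - σ * c₁ * w (1 + ε, x))) - (1 / 2 + σ * τ * c₁ / (2 * c₀))| ≤
      transErr k κ M L * N := by
  obtain ⟨h0, hk0, hκ⟩ := S.left_mem
  obtain ⟨h1, hk1, hκ1⟩ := S.right_mem
  have hk := S.k_pos
  have he := S.eps_pos
  have he1 := S.eps_le
  have hN := S.N_pos
  have hT := S.two_le
  have hκ0 : 0 < κ := h0.trans_le hκ
  have hκe : 0 < κ * ε := mul_pos hκ0 he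
  have hab : a ≤ b := by nlinarith
  have hL0 : 0 ≤ L := by linarith
  have hc0e : c₀ * ε ≤ κ * ε := mul_le_mul_of_nonneg_right hκ he.le
  have ht1 : (1 - ε) ∈ Icc 0 (1 - ε) := ⟨by linarith, le_rfl⟩
  -- masses of the Riemann invariants at time `1 - ε`
  have hmass : ∀ ρ : ℝ, ρ = 1 ∨ ρ = -1 →
      |(∫ x in a..b, (v (1 - ε, x) - ρ * c₀ * w (1 - ε, x))) - (1 + ρ * τ) / 2| ≤
        (2 + κ) * N * L := by
    intro ρ hρ
    have hBL : (2 + κ) * N * (b - a) ≤ (2 + κ) * N * L :=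
      mul_le_mul_of_nonneg_left hL (by positivity)
    refine le_trans ?_ hBL
    by_cases hρτ : ρ = τ
    · subst hρτ
      have e : (1 + ρ * ρ) / 2 = 1 := by rcases hρ with rfl | rfl <;> norm_num
      rw [e]
      have hρe : |ρ * (c₀ * ε)| ≤ κ * ε := by
        rw [abs_sign_mul hρ, abs_of_pos (mul_pos h0 he)]; exact hc0e
      rw [abs_le] at hρe
      exact S.integral_before hρ ht1 (fun x hx => by linarith [hX x hx]) (by linarith)
        (by linarith)
    · have e : ρ = -τ := by
        rcases hρ with rfl | rfl <;> rcases hτ with rfl | rfl <;>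
          first | exact absurd rfl hρτ | norm_num
      subst e
      have e2 : (1 + -τ * τ) / 2 = 0 := by rcases hτ with rfl | rfl <;> norm_num
      have h3 := abs_integral_sub_le hab (S.continuous_riemann (-τ * c₀) ht1.1)
        continuous_const (G := fun _ => 0) (B := (2 + κ) * N) fun x hx => by
          rw [sub_zero]
          refine S.before_small hρ ht1 (by linarith [hX x hx]) ?_
          have hx1 : τ * c₀ - c₀ ≤ x := ha'.trans hx.1
          have hx2 : x ≤ τ * c₀ + c₀ := hx.2.trans hb'
          rcases hτ with rfl | rfl
          · rw [lt_abs]; left; nlinarith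
          · rw [lt_abs]; right; nlinarith
      rw [e2]
      simpa using h3
  have iv : ∀ t, 0 ≤ t → IntervalIntegrable (fun x => v (t, x)) volume a b := fun t ht =>
    (WaveSystem.continuousOn_slice S.continuousOn_v ht).intervalIntegrable _ _
  have iw : ∀ t, 0 ≤ t → IntervalIntegrable (fun x => w (t, x)) volume a b := fun t ht =>
    (WaveSystem.continuousOn_slice S.continuousOn_w ht).intervalIntegrable _ _
  have hsplit : ∀ t, 0 ≤ t → ∀ r : ℝ, ∫ x in a..b, (v (t, x) - r * w (t, x)) =
      (∫ x in a..b, v (t, x)) - r * ∫ x in a..b, w (t, x) := fun t ht r => by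
    rw [intervalIntegral.integral_sub (iv t ht) ((iw t ht).const_mul r),
      intervalIntegral.integral_const_mul]
  -- smallness on the lateral boundary
  have hlat : ∀ y, (∀ τ' : ℝ, τ' = 1 ∨ τ' = -1 → (1 + 3 * κ) * ε < |y - τ' * c₀|) →
      y ∈ Icc a b → ∀ t ∈ Icc (1 - ε) (1 + ε), |v (t, y)| ≤ amp k κ M * N ∧
        |w (t, y)| ≤ amp k κ M * N / k := by
    intro y hy hyI t ht
    have hp := S.during_small (.inl rfl) ht (hX y hyI) hy
    have hq := S.during_small (.inr rfl) ht (hX y hyI) hy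
    rw [one_mul] at hp
    rw [show v (t, y) - -1 * c t * w (t, y) = v (t, y) + c t * w (t, y) by ring] at hq
    exact ⟨WaveSystem.abs_v_le hp hq, WaveSystem.abs_w_le hk (S.le_speed t) hp hq⟩
  have hfar : ∀ y ∈ Icc a b, (1 + 3 * κ) * ε < |y - τ * c₀| →
      ∀ τ' : ℝ, τ' = 1 ∨ τ' = -1 → (1 + 3 * κ) * ε < |y - τ' * c₀| := by
    intro y hy hd τ' hτ'
    have hx1 : τ * c₀ - c₀ ≤ y := ha'.trans hy.1
    have hx2 : y ≤ τ * c₀ + c₀ := hy.2.trans hb'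
    rcases hτ with rfl | rfl <;> rcases hτ' with rfl | rfl
    · exact hd
    · rw [lt_abs]; left; linarith
    · rw [lt_abs]; right; linarith
    · exact hd
  have hla := hlat a (hfar a ⟨le_rfl, hab⟩ (by rw [lt_abs]; right; linarith)) ⟨le_rfl, hab⟩
  have hlb := hlat b (hfar b ⟨hab, le_rfl⟩ (by rw [lt_abs]; left; linarith)) ⟨hab, le_rfl⟩
  have hamp : 0 ≤ amp k κ M := by linarith [S.le_amp]
  set A := amp k κ M * (1 + κ ^ 2 / k) * N with hA
  have hcc := S.continuous_speed
  have hG : ∀ y t, |w (t, y)| ≤ amp k κ M * N / k → |c t ^ 2 * w (t, y)| ≤ A := by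
    intro y t h
    rw [abs_mul, abs_of_nonneg (sq_nonneg _)]
    calc _ ≤ κ ^ 2 * (amp k κ M * N / k) := mul_le_mul
          (pow_le_pow_left₀ (hk.le.trans (S.le_speed t)) (S.speed_le t) 2) h (abs_nonneg _)
          (sq_nonneg _)
      _ ≤ κ ^ 2 * (amp k κ M * N / k) + amp k κ M * N :=
        le_add_of_nonneg_right (by positivity)
      _ = A := by rw [hA]; ring
  have hA1 : amp k κ M * N ≤ A := by
    have : 0 ≤ amp k κ M * N * (κ ^ 2 / k) := by positivity
    rw [hA]; nlinarith
  have hbal1 := abs_balance_le (t₁ := 1 - ε) (t₂ := 1 + ε) (N := N) (m := A)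
    (G := fun z => c z.1 ^ 2 * w z) (by linarith) (by linarith) hab S.continuousOn_v
    (((hcc.comp continuous_fst).pow 2).continuousOn.mul S.continuousOn_w) S.continuousOn_f
    S.differentiableAt_v
    (fun z hz => (((S.hasDerivAt_speed z.1).differentiableAt.comp z differentiableAt_fst).pow
      2).mul (S.differentiableAt_w z hz))
    (fun z hz => by
      have hd1 : HasFDerivAt (fun z : ℝ × ℝ => c z.1)
          (c' z.1 • ContinuousLinearMap.fst ℝ ℝ ℝ) z :=
        (S.hasDerivAt_speed z.1).comp_hasFDerivAt z hasFDerivAt_fst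
      have hd2 : HasFDerivAt (fun z : ℝ × ℝ => c z.1 ^ 2 * w z) _ z :=
        (hd1.pow 2).mul (S.differentiableAt_w z hz).hasFDerivAt
      rw [hd2.fderiv, S.wave z hz]
      simp)
    (fun t ht x hx => S.forcing t ⟨by linarith [ht.1], by linarith [ht.2]⟩ x
      (by linarith [hX x hx]))
    (fun t ht => hG a t (hla t ht).2) (fun t ht => hG b t (hlb t ht).2)
  have hbal2 := abs_balance_le (t₁ := 1 - ε) (t₂ := 1 + ε) (N := N) (m := A) (F := w) (G := v)
    (f := fun _ => 0) (by linarith) (by linarith) hab S.continuousOn_w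
    S.continuousOn_v continuousOn_const S.differentiableAt_w S.differentiableAt_v
    (fun z hz => by rw [S.symm z hz, add_zero])
    (fun t ht x hx => by simpa using hN.le)
    (fun t ht => (hla t ht).1.trans hA1) (fun t ht => (hlb t ht).1.trans hA1)
  have hm1 := hmass 1 (.inl rfl)
  have hm2 := hmass (-1) (.inr rfl)
  rw [hsplit _ ht1.1] at hm1 hm2
  rw [hsplit _ (by linarith)]
  set V₁ := ∫ x in a..b, v (1 - ε, x)
  set W₁ := ∫ x in a..b, w (1 - ε, x)
  set V₂ := ∫ x in a..b, v (1 + ε, x)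
  set W₂ := ∫ x in a..b, w (1 + ε, x)
  have hA0 : 0 ≤ A := (by positivity : (0 : ℝ) ≤ amp k κ M * N).trans hA1
  set D := (2 * A + N * L) * 2 with hD
  have hD0 : (2 * A + N * (b - a)) * (1 + ε - (1 - ε)) ≤ D := by
    have h3 : N * (b - a) ≤ N * L := mul_le_mul_of_nonneg_left hL hN.le
    have h4 : 0 ≤ N * (b - a) := mul_nonneg hN.le (by linarith)
    exact mul_le_mul (by linarith) (by linarith) (by linarith) (by positivity)
  have hV : |V₁ - 1 / 2| ≤ (2 + κ) * N * L := by
    rw [abs_le] at *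
    constructor <;> linarith
  have hW : |W₁ + τ / (2 * c₀)| ≤ (2 + κ) * N * L / k := by
    have h3 : |c₀ * (W₁ + τ / (2 * c₀))| ≤ (2 + κ) * N * L := by
      have e : c₀ * (W₁ + τ / (2 * c₀)) = c₀ * W₁ + τ / 2 := by field_simp
      rw [e]
      rw [abs_le] at *
      constructor <;> linarith
    rw [abs_mul, abs_of_pos h0] at h3
    rw [le_div_iff₀ hk]
    nlinarith [abs_nonneg (W₁ + τ / (2 * c₀))]
  have hid : V₂ - σ * c₁ * W₂ - (1 / 2 + σ * τ * c₁ / (2 * c₀)) =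
      ((V₂ - V₁) + (V₁ - 1 / 2)) - σ * (c₁ * ((W₂ - W₁) + (W₁ + τ / (2 * c₀)))) := by ring
  rw [hid]
  have hVV : |(V₂ - V₁) + (V₁ - 1 / 2)| ≤ D + (2 + κ) * N * L :=
    (abs_add_le _ _).trans (add_le_add (hbal1.trans hD0) hV)
  have hWW : |(W₂ - W₁) + (W₁ + τ / (2 * c₀))| ≤ D + (2 + κ) * N * L / k :=
    (abs_add_le _ _).trans (add_le_add (hbal2.trans hD0) hW)
  have hfin : |σ * (c₁ * ((W₂ - W₁) + (W₁ + τ / (2 * c₀))))| ≤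
      κ * (D + (2 + κ) * N * L / k) := by
    rw [abs_sign_mul hσ, abs_mul, abs_of_pos h1]
    exact mul_le_mul hκ1 hWW (abs_nonneg _) hκ0.le
  calc _ ≤ _ := abs_sub _ _
    _ ≤ D + (2 + κ) * N * L + κ * (D + (2 + κ) * N * L / k) := add_le_add hVV hfin
    _ ≤ transErr k κ M L * N := by
      have : 0 ≤ κ * L * (2 + κ) * N + κ * N * L * 2 * (1 + κ) := by positivity
      have e : transErr k κ M L * N = D + (2 + κ) * N * L + κ * (D + (2 + κ) * N * L / k) +
          (κ * L * (2 + κ) * N + κ * N * L * 2 * (1 + κ)) := by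
        rw [hD, hA]; unfold transErr; ring
      linarith

/-- After the transition the mass of each pulse is transported. -/
theorem integral_after (S : Scattering c₀ c₁ k κ M T X ε N g c c' v w f) {σ τ t ρ : ℝ}
    (hσ : σ = 1 ∨ σ = -1) (hτ : τ = 1 ∨ τ = -1) (ht : t ∈ Icc (1 + ε) T)
    (hX : ∀ x, |x| ≤ c₀ + κ * T + ρ → |x| + κ * (T + 4) ≤ X)
    (hρ : (1 + 4 * κ) * ε < ρ) (hρ' : ρ + κ * ε ≤ c₀) :
    |(∫ x in (τ * c₀ + σ * c₁ * (t - 1) - ρ)..(τ * c₀ + σ * c₁ * (t - 1) + ρ),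
      (v (t, x) - σ * c₁ * w (t, x))) - (1 / 2 + σ * τ * c₁ / (2 * c₀))| ≤
      (transErr k κ M (2 * ρ) + 2 * ρ * T) * N := by
  obtain ⟨h0, hk0, hκ⟩ := S.left_mem
  obtain ⟨h1, hk1, hκ1⟩ := S.right_mem
  have he := S.eps_pos
  have hT := S.two_le
  have hN := S.N_pos
  have hκ0 : 0 < κ := h0.trans_le hκ
  have hκe : 0 < κ * ε := mul_pos hκ0 he
  have hc1e : c₁ * ε ≤ κ * ε := mul_le_mul_of_nonneg_right hκ1 he.le
  have hρ0 : 0 < ρ := by nlinarith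
  set x' := τ * c₀ + σ * c₁ * (t - 1) with hx'
  have hx'b : |x'| ≤ c₀ + κ * T := by
    rw [hx', mul_assoc]
    refine (abs_add_le _ _).trans ?_
    rw [abs_sign_mul hτ, abs_sign_mul hσ, abs_of_pos h0,
      abs_of_nonneg (mul_nonneg h1.le (by linarith [ht.1]))]
    gcongr
    · linarith [ht.1]
    · linarith [ht.2]
  set d := σ * c₁ * (1 + ε - t) with hd
  have hsh : ∫ x in (x' - ρ)..(x' + ρ), (v (1 + ε, x + d) - σ * c₁ * w (1 + ε, x + d)) =
      ∫ x in (x' - ρ + d)..(x' + ρ + d), (v (1 + ε, x) - σ * c₁ * w (1 + ε, x)) :=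
    intervalIntegral.integral_comp_add_right
      (fun x => v (1 + ε, x) - σ * c₁ * w (1 + ε, x)) d
  have hxd : x' + d = τ * c₀ + σ * (c₁ * ε) := by rw [hx', hd]; ring
  have hσe : |σ * (c₁ * ε)| ≤ κ * ε := by
    rw [abs_sign_mul hσ, abs_of_pos (mul_pos h1 he)]; exact hc1e
  have hτ0 : |τ * c₀| = c₀ := by rw [abs_sign_mul hτ, abs_of_pos h0]
  have hκT : κ * 2 ≤ κ * T := mul_le_mul_of_nonneg_left hT hκ0.le
  have hσe' := abs_le.1 hσe
  have hB := S.integral_transition (a := x' - ρ + d) (b := x' + ρ + d) (L := 2 * ρ) hσ hτ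
    (fun x hx => by
      have h2 : |x - τ * c₀| ≤ c₀ := by
        rw [abs_le]
        constructor <;> linarith [hx.1, hx.2]
      have h3 : |x| ≤ c₀ + c₀ := by
        have := abs_add_le (x - τ * c₀) (τ * c₀)
        rw [sub_add_cancel] at this
        linarith
      have := hX x (by linarith)
      linarith) (by linarith) (by linarith) (by linarith) (by linarith) (by linarith)
      (by linarith)
  rw [← hsh] at hB
  have hA := abs_integral_sub_le (a := x' - ρ) (b := x' + ρ) (B := T * N) (by linarith)
    (S.continuous_riemann (σ * c₁) (by linarith [ht.1] : (0 : ℝ) ≤ t))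
    ((S.continuous_riemann (σ * c₁) (by linarith : (0 : ℝ) ≤ 1 + ε)).comp
      (continuous_id.add (continuous_const (y := d))))
    (fun x hx => by
      refine S.after hσ ht ?_
      have h2 : |x - x'| ≤ ρ := by
        rw [abs_le]
        constructor <;> linarith [hx.1, hx.2]
      have h3 := abs_add_le (x - x') x'
      rw [sub_add_cancel] at h3
      have := hX x (by linarith)
      linarith)
  simp only [Function.comp_apply, Pi.add_apply, id] at hA
  rw [abs_le] at hA hB ⊢
  constructor <;> linarith

end Scattering
end Colombeau

namespace Colombeau

namespace Mollifier

variable (φ : Mollifier)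

theorem eq_zero_of_one_le_abs {x : ℝ} (hx : 1 ≤ |x|) : φ.toFun x = 0 := by
  have h1 : ∀ y, 1 < |y| → φ.toFun y = 0 := fun y hy => by
    by_contra h
    have h2 := φ.supp (subset_tsupport _ h)
    exact absurd (abs_le.2 h2) (not_le.2 hy)
  have h2 : closure {y : ℝ | 1 < |y|} ⊆ {y | φ.toFun y = 0} :=
    closure_minimal h1 (isClosed_singleton.preimage φ.smooth.continuous)
  refine h2 (mem_closure_of_tendsto (f := fun n : ℕ => (1 + 1 / ((n : ℝ) + 1)) * x)
    (b := atTop) ?_ (Eventually.of_forall fun n => ?_))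
  · have := (tendsto_one_div_add_atTop_nhds_zero_nat (𝕜 := ℝ)).const_add 1
    simpa using this.mul_const x
  · have h3 : (0 : ℝ) < 1 / ((n : ℝ) + 1) := by positivity
    change 1 < |(1 + 1 / ((n : ℝ) + 1)) * x|
    rw [abs_mul, abs_of_pos (by linarith)]
    nlinarith

theorem nonneg (x : ℝ) : 0 ≤ φ.toFun x := by
  wlog hx : x ≤ 0 generalizing x
  · rw [← φ.symmetric]
    exact this (-x) (by linarith)
  rcases le_total x (-1) with h | h
  · rw [φ.eq_zero_of_one_le_abs (by rw [abs_of_nonpos hx]; linarith)]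
  · have h1 : MonotoneOn φ.toFun (Icc (-1) 0) :=
      monotoneOn_of_deriv_nonneg (convex_Icc _ _) φ.smooth.continuous.continuousOn
        (φ.smooth.differentiable (by simp)).differentiableOn
        fun y hy => φ.deriv_nonneg y (interior_subset hy)
    have h2 := h1 (left_mem_Icc.2 (by norm_num)) ⟨h, hx⟩ h
    rwa [φ.eq_zero_of_one_le_abs (by norm_num)] at h2

theorem scaled_nonneg (ε : Scale) (x : ℝ) : 0 ≤ φ.scaled ε x :=
  div_nonneg (φ.nonneg _) ε.2.1.le

theorem scaled_eq_zero (ε : Scale) {x : ℝ} (hx : (ε : ℝ) ≤ |x|) : φ.scaled ε x = 0 := by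
  have hε := ε.2.1
  unfold scaled
  rw [φ.eq_zero_of_one_le_abs, zero_div]
  rwa [abs_div, abs_of_pos hε, le_div_iff₀ hε, one_mul]

theorem integral_scaled (ε : Scale) : ∫ x, φ.scaled ε x = 1 := by
  have hε := ε.2.1
  rw [φ.scaled_eq, integral_const_mul, Measure.integral_comp_mul_left φ.toFun,
    φ.integral_eq_one, inv_inv, abs_of_pos hε, smul_eq_mul, mul_one, inv_mul_cancel₀ hε.ne']

theorem integrable_scaled (ε : Scale) : Integrable (φ.scaled ε) :=
  (φ.contDiff_scaled ε).continuous.integrable_of_hasCompactSupport (φ.hasCompactSupport_scaled ε)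

theorem intervalIntegral_scaled (ε : Scale) {a b : ℝ} (ha : a ≤ -ε) (hb : (ε : ℝ) ≤ b) :
    ∫ x in a..b, φ.scaled ε x = 1 := by
  rw [intervalIntegral.integral_eq_integral_of_support_subset, φ.integral_scaled]
  intro x hx
  have h : |x| < ε := not_le.1 fun h => hx (φ.scaled_eq_zero ε h)
  rw [abs_lt] at h
  exact ⟨by linarith [h.1], by linarith [h.2]⟩

theorem regularize_apply (f : ℝ → ℝ) (ε : Scale) (t : ℝ) :
    φ.regularize f ε t = ∫ s, f s * φ.scaled ε (t - s) := by
  simp [regularize, convolution]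

theorem integrable_mul_scaled {f : ℝ → ℝ} (hf : Measurable f) {B : ℝ} (hB : ∀ s, |f s| ≤ B)
    (ε : Scale) (t : ℝ) : Integrable fun s => f s * φ.scaled ε (t - s) :=
  ((φ.integrable_scaled ε).comp_sub_left t).bdd_mul hf.aestronglyMeasurable
    (Eventually.of_forall hB)

theorem regularize_le {f : ℝ → ℝ} (hf : Measurable f) {B : ℝ} (hB : ∀ s, |f s| ≤ B) {C : ℝ}
    {ε : Scale} {t : ℝ} (h : ∀ s, |t - s| < ε → f s ≤ C) : φ.regularize f ε t ≤ C := by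
  rw [regularize_apply]
  calc _ ≤ ∫ s, C * φ.scaled ε (t - s) := by
        refine integral_mono (φ.integrable_mul_scaled hf hB ε t)
          (((φ.integrable_scaled ε).comp_sub_left t).const_mul C) fun s => ?_
        rcases lt_or_ge |t - s| ε with hs | hs
        · exact mul_le_mul_of_nonneg_right (h s hs) (φ.scaled_nonneg _ _)
        · simp [φ.scaled_eq_zero ε hs]
    _ = C := by
        rw [integral_const_mul, integral_sub_left_eq_self (fun t => φ.scaled ε t) volume t,
          φ.integral_scaled, mul_one]

theorem le_regularize {f : ℝ → ℝ} (hf : Measurable f) {B : ℝ} (hB : ∀ s, |f s| ≤ B) {C : ℝ}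
    {ε : Scale} {t : ℝ} (h : ∀ s, |t - s| < ε → C ≤ f s) : C ≤ φ.regularize f ε t := by
  have h1 := φ.regularize_le (f := fun s => -f s) hf.neg (B := B) (by simpa using hB) (C := -C)
    (ε := ε) (t := t) fun s hs => neg_le_neg (h s hs)
  rw [regularize_apply] at h1 ⊢
  simp only [neg_mul, integral_neg] at h1
  linarith

variable (c₀ c₁ : ℝ)

theorem regularize_speed_left (ε : Scale) {t : ℝ} (ht : t ≤ 1 - ε) :
    φ.regularize (speed c₀ c₁) ε t = c₀ := by
  have h : ∀ s, |t - s| < ε → speed c₀ c₁ s = c₀ := fun s hs => by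
    have : ¬ (0 ≤ s - 1) := by
      rw [abs_lt] at hs
      linarith [hs.1]
    simp [speed, heaviside, this]
  exact le_antisymm
    (φ.regularize_le (measurable_speed c₀ c₁) (abs_speed_le c₀ c₁) fun s hs => (h s hs).le)
    (φ.le_regularize (measurable_speed c₀ c₁) (abs_speed_le c₀ c₁) fun s hs => (h s hs).ge)

theorem regularize_speed_right (ε : Scale) {t : ℝ} (ht : 1 + ε ≤ t) :
    φ.regularize (speed c₀ c₁) ε t = c₁ := by
  have h : ∀ s, |t - s| < ε → speed c₀ c₁ s = c₁ := fun s hs => by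
    have : 0 ≤ s - 1 := by
      rw [abs_lt] at hs
      linarith [hs.2]
    simp [speed, heaviside, this]
  exact le_antisymm
    (φ.regularize_le (measurable_speed c₀ c₁) (abs_speed_le c₀ c₁) fun s hs => (h s hs).le)
    (φ.le_regularize (measurable_speed c₀ c₁) (abs_speed_le c₀ c₁) fun s hs => (h s hs).ge)

theorem speed_eq (s : ℝ) : speed c₀ c₁ s = c₀ ∨ speed c₀ c₁ s = c₁ := by
  unfold speed heaviside
  split_ifs <;> simp

theorem regularize_speed_le (ε : Scale) (t : ℝ) :
    φ.regularize (speed c₀ c₁) ε t ≤ max c₀ c₁ :=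
  φ.regularize_le (measurable_speed c₀ c₁) (abs_speed_le c₀ c₁) fun s _ => by
    rcases speed_eq c₀ c₁ s with h | h <;> simp [h]

theorem le_regularize_speed (ε : Scale) (t : ℝ) :
    min c₀ c₁ ≤ φ.regularize (speed c₀ c₁) ε t :=
  φ.le_regularize (measurable_speed c₀ c₁) (abs_speed_le c₀ c₁) fun s _ => by
    rcases speed_eq c₀ c₁ s with h | h <;> simp [h]

theorem contDiff_regularize {f : ℝ → ℝ} (hf : LocallyIntegrable f) (ε : Scale) :
    ContDiff ℝ ∞ (φ.regularize f ε) :=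
  (φ.hasCompactSupport_scaled ε).contDiff_convolution_right _ hf (φ.contDiff_scaled ε)

theorem abs_deriv_regularize_le {f : ℝ → ℝ} (hf : LocallyIntegrable f) {B : ℝ}
    (hB : ∀ x, |f x| ≤ B) (ε : Scale) (t : ℝ) :
    |_root_.deriv (φ.regularize f ε) t| ≤ (B * ∫ y, |iteratedDeriv 1 φ.toFun y|) / ε := by
  have hε : 0 < (ε : ℝ) := ε.2.1
  rw [← iteratedDeriv_one, regularize, iteratedDeriv_convolution hf
    (φ.hasCompactSupport_scaled ε) (φ.contDiff_scaled ε), convolution]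
  have hint : Integrable (iteratedDeriv 1 (φ.scaled ε)) :=
    ((φ.contDiff_scaled ε).continuous_iteratedDeriv 1
      (by exact_mod_cast le_top)).integrable_of_hasCompactSupport
      (hasCompactSupport_iteratedDeriv (φ.hasCompactSupport_scaled ε) 1)
  have h1 : ∫ s, |iteratedDeriv 1 (φ.scaled ε) (t - s)| =
      (ε : ℝ)⁻¹ * ∫ y, |iteratedDeriv 1 φ.toFun y| := by
    rw [integral_sub_left_eq_self (fun t => |iteratedDeriv 1 (φ.scaled ε) t|) volume t]
    simp_rw [φ.iteratedDeriv_scaled, abs_mul]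
    rw [integral_const_mul, Measure.integral_comp_mul_left
      (fun y => |iteratedDeriv 1 φ.toFun y|)]
    rw [abs_of_nonneg (by positivity), inv_inv, abs_of_pos hε, smul_eq_mul,
      ← mul_assoc, pow_succ, pow_one, mul_assoc (ε : ℝ)⁻¹, inv_mul_cancel₀ hε.ne', mul_one]
  calc _ ≤ ∫ s, B * |iteratedDeriv 1 (φ.scaled ε) (t - s)| := by
        change ‖∫ s, (ContinuousLinearMap.mul ℝ ℝ) (f s)
          (iteratedDeriv 1 (φ.scaled ε) (t - s))‖ ≤ _
        refine norm_integral_le_of_norm_le ((hint.comp_sub_left t).abs.const_mul B)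
          (Eventually.of_forall fun s => ?_)
        rw [ContinuousLinearMap.mul_apply', norm_mul, Real.norm_eq_abs, Real.norm_eq_abs]
        exact mul_le_mul_of_nonneg_right (hB s) (abs_nonneg _)
    _ = _ := by rw [integral_const_mul, h1]; field_simp

end Mollifier
end Colombeau

namespace Colombeau

section
variable {E : Type*} [NormedAddCommGroup E] [NormedSpace ℝ E]

theorem hasDerivWithinAt_line {Ω : Domain E} {f : E → ℝ} (hf : ContDiffOn ℝ ∞ f Ω.carrier) {z v : E}
    {s : Set ℝ} (hs : ∀ r ∈ s, z + r • v ∈ Ω.carrier) {r : ℝ} (hr : r ∈ s) :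
    HasDerivWithinAt (fun r => f (z + r • v)) (fderivWithin ℝ f Ω.carrier (z + r • v) v) s r := by
  have h1 : HasFDerivWithinAt f (fderivWithin ℝ f Ω.carrier (z + r • v)) Ω.carrier (z + r • v) :=
    ((hf _ (hs r hr)).differentiableWithinAt (by simp)).hasFDerivWithinAt
  have h2 : HasDerivWithinAt (fun r : ℝ => z + r • v) v s r := by
    simpa using (((hasDerivAt_id r).smul_const v).const_add z).hasDerivWithinAt
  exact h1.comp_hasDerivWithinAt r h2 fun y hy => hs y hy

theorem DerivBound.abs_le {Ω : Domain E} {K : Set E} {r : ℝ} {u : Scale → E → ℝ}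
    (h : DerivBound Ω K 0 r u) : ∃ C : ℝ, 0 ≤ C ∧ ∃ η : ℝ, 0 < η ∧ ∀ ε : Scale, (ε : ℝ) < η →
      ∀ x ∈ K, |u ε x| ≤ C * (ε : ℝ) ^ r := by
  obtain ⟨C, η, hη, hC⟩ := h
  refine ⟨|C|, abs_nonneg C, η, hη, fun ε hε x hx => ?_⟩
  have h1 := hC ε hε x hx
  rw [norm_iteratedFDerivWithin_zero, Real.norm_eq_abs] at h1
  exact h1.trans (mul_le_mul_of_nonneg_right (le_abs_self C) (Real.rpow_nonneg ε.2.1.le _))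

theorem DerivBound.of_abs_le {Ω : Domain E} {K : Set E} {r C η : ℝ} {u : Scale → E → ℝ}
    (hη : 0 < η) (h : ∀ ε : Scale, (ε : ℝ) < η → ∀ x ∈ K, |u ε x| ≤ C * (ε : ℝ) ^ r) :
    DerivBound Ω K 0 r u :=
  ⟨C, η, hη, fun ε hε x hx => by
    rw [norm_iteratedFDerivWithin_zero, Real.norm_eq_abs]
    exact h ε hε x hx⟩

/-- Landau type interpolation: the derivative in an inward direction of a moderate net whose
values are negligible is itself negligible in the sup norm. -/
theorem derivBound_dirDeriv_of_sup {Ω : Domain E} {u : Scale → E → ℝ} (hu : IsModerate Ω u)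
    (h0 : ∀ K : Set E, IsCompact K → K ⊆ Ω.carrier → ∀ q : ℝ, 0 ≤ q → DerivBound Ω K 0 q u)
    {v : E} {K : Set E} (hK : IsCompact K) {δ : ℝ} (hδ : 0 < δ)
    (hin : ∀ z ∈ K, ∀ r ∈ Icc 0 δ, z + r • v ∈ Ω.carrier) {q : ℝ} (hq : 0 ≤ q) :
    DerivBound Ω K 0 q (fun ε x => fderivWithin ℝ (u ε) Ω.carrier x v) := by
  set K' : Set E := (fun p : E × ℝ => p.1 + p.2 • v) '' (K ×ˢ Icc 0 δ) with hK'
  have hK'c : IsCompact K' := (hK.prod isCompact_Icc).image (by fun_prop)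
  have hK'Ω : K' ⊆ Ω.carrier := by
    rintro _ ⟨⟨z, r⟩, ⟨hz, hr⟩, rfl⟩
    exact hin z hz r hr
  have hmem : ∀ z ∈ K, ∀ r ∈ Icc 0 δ, z + r • v ∈ K' := fun z hz r hr =>
    ⟨(z, r), ⟨hz, hr⟩, rfl⟩
  obtain ⟨p, hp, hb⟩ := (netDeriv v (netDeriv v ⟨u, hu⟩)).2.2 K' hK'c hK'Ω 0
  obtain ⟨D, hD, η₁, hη₁, hD'⟩ := hb.abs_le
  obtain ⟨C, hC, η₂, hη₂, hC'⟩ := (h0 K' hK'c hK'Ω (p + 2 * q) (by positivity)).abs_le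
  refine DerivBound.of_abs_le (C := 2 * C / δ + δ * D) (lt_min hη₁ hη₂) fun ε hε z hz => ?_
  have hε0 : 0 < (ε : ℝ) := ε.2.1
  set h : ℝ := δ * (ε : ℝ) ^ (p + q) with hh
  have hpos : 0 < h := mul_pos hδ (Real.rpow_pos_of_pos hε0 _)
  have hle : h ≤ δ :=
    mul_le_of_le_one_right hδ.le (Real.rpow_le_one hε0.le ε.2.2 (by positivity))
  have hsub : ∀ r ∈ Icc 0 h, r ∈ Icc 0 δ := fun r hr => ⟨hr.1, hr.2.trans hle⟩
  have hΩ : ∀ r ∈ Icc 0 h, z + r • v ∈ Ω.carrier := fun r hr => hin z hz r (hsub r hr)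
  have hd1 : ∀ r ∈ Icc 0 h, HasDerivWithinAt (fun r => u ε (z + r • v))
      (fderivWithin ℝ (u ε) Ω.carrier (z + r • v) v) (Icc 0 h) r := fun r hr =>
    hasDerivWithinAt_line (hu.1 ε) hΩ hr
  have hd2 : ∀ r ∈ Icc 0 h, HasDerivWithinAt
      (fun r => fderivWithin ℝ (u ε) Ω.carrier (z + r • v) v)
      ((netDeriv v (netDeriv v ⟨u, hu⟩)).1 ε (z + r • v)) (Icc 0 h) r := fun r hr =>
    hasDerivWithinAt_line (contDiffOn_dirDeriv (hu.1 ε) v) hΩ hr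
  set g' : ℝ → ℝ := fun r => fderivWithin ℝ (u ε) Ω.carrier (z + r • v) v with hg'
  set B := D * (ε : ℝ) ^ (-p) with hB
  have hB0 : 0 ≤ B := mul_nonneg hD (Real.rpow_nonneg hε0.le _)
  have e1 : ∀ r ∈ Icc 0 h, |g' r - g' 0| ≤ B * h := fun r hr => by
    have h1 := norm_image_sub_le_of_norm_deriv_le_segment' (C := B) hd2
      (fun s hs => hD' ε (hε.trans_le (min_le_left _ _)) _
        (hmem z hz s (hsub s (Ico_subset_Icc_self hs)))) r hr
    rw [sub_zero] at h1
    exact h1.trans (mul_le_mul_of_nonneg_left hr.2 hB0)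
  have e2 := norm_image_sub_le_of_norm_deriv_le_segment' (C := B * h)
    (f := fun r => u ε (z + r • v) - r * g' 0) (f' := fun r => g' r - g' 0)
    (fun r hr => (hd1 r hr).sub (by simpa using (hasDerivWithinAt_id r _).mul_const (g' 0)))
    (fun r hr => e1 r (Ico_subset_Icc_self hr)) h ⟨hpos.le, le_rfl⟩
  have hu1 := hC' ε (hε.trans_le (min_le_right _ _)) _ (hmem z hz h (hsub h ⟨hpos.le, le_rfl⟩))
  have hu0 := hC' ε (hε.trans_le (min_le_right _ _)) _ (hmem z hz 0 (hsub 0 ⟨le_rfl, hpos.le⟩))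
  rw [Real.norm_eq_abs] at e2
  have e3 : |h * g' 0| ≤ 2 * (C * (ε : ℝ) ^ (p + 2 * q)) + B * h * h := by
    rw [_root_.abs_le] at *
    constructor <;> linarith
  rw [abs_mul, abs_of_pos hpos] at e3
  have e4 : g' 0 = fderivWithin ℝ (u ε) Ω.carrier z v := by simp [hg']
  rw [← e4]
  have e5 : (ε : ℝ) ^ (p + 2 * q) = (ε : ℝ) ^ (p + q) * (ε : ℝ) ^ q := by
    rw [← Real.rpow_add hε0]; congr 1; ring
  have e6 : B * h = δ * D * (ε : ℝ) ^ q := by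
    have : (ε : ℝ) ^ (p + q) = (ε : ℝ) ^ p * (ε : ℝ) ^ q := Real.rpow_add hε0 _ _
    rw [hB, hh, this, Real.rpow_neg hε0.le]
    have := (Real.rpow_pos_of_pos hε0 p).ne'
    field_simp
  have e7 : 2 * (C * (ε : ℝ) ^ (p + 2 * q)) + B * h * h =
      h * ((2 * C / δ + δ * D) * (ε : ℝ) ^ q) := by
    rw [e6, e5, hh]; field_simp
  rw [e7] at e3
  exact le_of_mul_le_mul_left e3 hpos

theorem norm_iteratedFDerivWithin_succ_le {Ω : Domain (ℝ × ℝ)} {f : ℝ × ℝ → ℝ}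
    (hf : ContDiffOn ℝ ∞ f Ω.carrier) (n : ℕ) {z : ℝ × ℝ} (hz : z ∈ Ω.carrier) :
    ‖iteratedFDerivWithin ℝ (n + 1) f Ω.carrier z‖ ≤
      ‖iteratedFDerivWithin ℝ n (fun y => fderivWithin ℝ f Ω.carrier y (1, 0)) Ω.carrier z‖ +
      ‖iteratedFDerivWithin ℝ n (fun y => fderivWithin ℝ f Ω.carrier y (0, 1)) Ω.carrier z‖ := by
  set L : (ℝ × ℝ →L[ℝ] ℝ) → ℝ →L[ℝ] (ℝ × ℝ →L[ℝ] ℝ) := fun ℓ =>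
    (ContinuousLinearMap.id ℝ ℝ).smulRight ℓ with hL
  have hLn : ∀ ℓ, ‖ℓ‖ ≤ 1 → ‖L ℓ‖ ≤ 1 := fun ℓ hℓ => by
    rw [hL]
    simp only [ContinuousLinearMap.norm_smulRight_apply, ContinuousLinearMap.norm_id, one_mul]
    exact hℓ
  have hdec : fderivWithin ℝ f Ω.carrier =
      (L (ContinuousLinearMap.fst ℝ ℝ ℝ) ∘ fun y => fderivWithin ℝ f Ω.carrier y (1, 0)) +
      (L (ContinuousLinearMap.snd ℝ ℝ ℝ) ∘ fun y => fderivWithin ℝ f Ω.carrier y (0, 1)) := by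
    ext y <;> simp [hL]
  have hs : ∀ v : ℝ × ℝ, ContDiffWithinAt ℝ n (fun y => fderivWithin ℝ f Ω.carrier y v)
      Ω.carrier z := fun v => (contDiffOn_dirDeriv hf v z hz).of_le (by exact_mod_cast le_top)
  rw [← norm_iteratedFDerivWithin_fderivWithin Ω.uniqueDiffOn hz]
  conv_lhs => rw [hdec]
  rw [iteratedFDerivWithin_add_apply ((L _).contDiff.comp_contDiffWithinAt (hs _))
      ((L _).contDiff.comp_contDiffWithinAt (hs _)) Ω.uniqueDiffOn hz]
  refine (norm_add_le _ _).trans (add_le_add ?_ ?_)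
  · refine ((L _).norm_iteratedFDerivWithin_comp_left (hs _) Ω.uniqueDiffOn hz le_rfl).trans ?_
    exact mul_le_of_le_one_left (norm_nonneg _) (hLn _ (ContinuousLinearMap.norm_fst_le ..))
  · refine ((L _).norm_iteratedFDerivWithin_comp_left (hs _) Ω.uniqueDiffOn hz le_rfl).trans ?_
    exact mul_le_of_le_one_left (norm_nonneg _) (hLn _ (ContinuousLinearMap.norm_snd_le ..))

end

theorem exists_inward {O : TopologicalSpace.Opens (ℝ × ℝ)} {v : ℝ × ℝ} (hv : 0 ≤ v.1)
    {K : Set (ℝ × ℝ)} (hK : IsCompact K) (hKΩ : K ⊆ (halfPlane.inter O).carrier) :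
    ∃ δ > 0, ∀ z ∈ K, ∀ r ∈ Icc (0 : ℝ) δ, z + r • v ∈ (halfPlane.inter O).carrier := by
  obtain ⟨δ, hδ, hsub⟩ := hK.exists_cthickening_subset_open O.isOpen fun z hz => (hKΩ hz).2
  refine ⟨δ / (‖v‖ + 1), by positivity, fun z hz r hr => ⟨⟨?_, mem_univ _⟩, hsub ?_⟩⟩
  · have h1 : 0 ≤ z.1 := (hKΩ hz).1.1
    have h2 := mul_nonneg hr.1 hv
    simpa using add_nonneg h1 h2
  · refine Metric.mem_cthickening_of_dist_le _ z _ _ hz ?_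
    rw [dist_eq_norm, add_sub_cancel_left, norm_smul, Real.norm_eq_abs, abs_of_nonneg hr.1]
    have h1 := hr.2
    rw [le_div_iff₀ (by positivity)] at h1
    nlinarith [norm_nonneg v, hr.1]

theorem isNegligible_of_sup {O : TopologicalSpace.Opens (ℝ × ℝ)} {u : Scale → ℝ × ℝ → ℝ}
    (hu : IsModerate (halfPlane.inter O) u)
    (h0 : ∀ K : Set (ℝ × ℝ), IsCompact K → K ⊆ (halfPlane.inter O).carrier → ∀ q : ℝ, 0 ≤ q →
      DerivBound (halfPlane.inter O) K 0 q u) : IsNegligible (halfPlane.inter O) u := by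
  refine ⟨hu.1, fun K hK hKΩ n => ?_⟩
  induction n generalizing u with
  | zero => exact h0 K hK hKΩ
  | succ n ih =>
    intro q hq
    have key : ∀ v : ℝ × ℝ, 0 ≤ v.1 → DerivBound (halfPlane.inter O) K n q
        (fun ε x => fderivWithin ℝ (u ε) (halfPlane.inter O).carrier x v) := fun v hv =>
      ih (netDeriv v ⟨u, hu⟩).2 (fun K' hK' hK'Ω q' hq' => by
        obtain ⟨δ, hδ, hin⟩ := exists_inward hv hK' hK'Ω
        exact derivBound_dirDeriv_of_sup hu h0 hK' hδ hin hq') q hq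
    obtain ⟨C, η, hη, hC⟩ := key (1, 0) zero_le_one
    obtain ⟨D, θ, hθ, hD⟩ := key (0, 1) le_rfl
    refine ⟨C + D, min η θ, lt_min hη hθ, fun ε hε z hz => ?_⟩
    refine (norm_iteratedFDerivWithin_succ_le (hu.1 ε) n (hKΩ hz)).trans ?_
    rw [add_mul]
    exact add_le_add (hC ε (hε.trans_le (min_le_left _ _)) z hz)
      (hD ε (hε.trans_le (min_le_right _ _)) z hz)

end Colombeau

namespace Colombeau

section
variable {E : Type*} [NormedAddCommGroup E] [NormedSpace ℝ E]

theorem GenFun.mk_eq_mk_iff {Ω : Domain E} {u v : Scale → E → ℝ} (hu : IsModerate Ω u)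
    (hv : IsModerate Ω v) : GenFun.mk u hu = GenFun.mk v hv ↔ IsNegligible Ω (u - v) :=
  Ideal.Quotient.eq

theorem GenFun.exists_rep {Ω : Domain E} (U : GenFun Ω) : ∃ u : moderate Ω, GenFun.mk u.1 u.2 = U :=
  Ideal.Quotient.mk_surjective U

theorem IsNegligible.abs_le {Ω : Domain E} {u : Scale → E → ℝ} (hu : IsNegligible Ω u) {K : Set E}
    (hK : IsCompact K) (hKΩ : K ⊆ Ω.carrier) {q : ℝ} (hq : 0 ≤ q) :
    ∃ C : ℝ, 0 ≤ C ∧ ∃ η : ℝ, 0 < η ∧ ∀ ε : Scale, (ε : ℝ) < η →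
      ∀ x ∈ K, |u ε x| ≤ C * (ε : ℝ) ^ q :=
  (hu.2 K hK hKΩ 0 q hq).abs_le

end

theorem halfPlane_mem_nhds {z : ℝ × ℝ} (hz : 0 < z.1) : halfPlane.carrier ∈ 𝓝 z :=
  mem_of_superset ((isOpen_Ioi.prod isOpen_univ).mem_nhds (⟨hz, mem_univ _⟩ :
    z ∈ Ioi (0 : ℝ) ×ˢ (univ : Set ℝ))) (prod_mono Ioi_subset_Ici_self Subset.rfl)

/-- The coefficient net. -/
noncomputable def Mollifier.coeffNet (φ : Mollifier) (c₀ c₁ : ℝ) : moderate halfPlane :=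
  ⟨fun ε z => φ.regularize (speed c₀ c₁) ε z.1,
    ((φ.isModerate_regularize (locallyIntegrable_speed c₀ c₁) _ (abs_speed_le c₀ c₁)).comp
      (ContinuousLinearMap.fst ℝ ℝ ℝ) uniqueDiffOn_univ (subset_univ _))⟩

/-- The residual `∂_t² u - c_ε² ∂_x² u`. -/
noncomputable def residual (φ : Mollifier) (c₀ c₁ : ℝ) (u : moderate halfPlane) :
    moderate halfPlane :=
  netDeriv (1, 0) (netDeriv (1, 0) u) -
    φ.coeffNet c₀ c₁ ^ 2 * netDeriv (0, 1) (netDeriv (0, 1) u)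

section
variable {c₀ c₁ : ℝ} {φ ψ : Mollifier} {u : moderate halfPlane}

theorem isNegligible_residual
    (hU : IsWaveSolution (φ.coefficient c₀ c₁) 0 ψ.delta (GenFun.mk u.1 u.2)) :
    IsNegligible halfPlane (residual φ c₀ c₁ u).1 :=
  Ideal.Quotient.eq_zero_iff_mem.1 hU.equation

theorem isNegligible_trace
    (hU : IsWaveSolution (φ.coefficient c₀ c₁) 0 ψ.delta (GenFun.mk u.1 u.2)) :
    IsNegligible (Domain.whole ℝ) (netTrace u).1 :=
  Ideal.Quotient.eq_zero_iff_mem.1 hU.initial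

theorem isNegligible_trace_dt
    (hU : IsWaveSolution (φ.coefficient c₀ c₁) 0 ψ.delta (GenFun.mk u.1 u.2)) :
    IsNegligible (Domain.whole ℝ) ((netTrace (netDeriv (1, 0) u)).1 - ψ.scaled) :=
  (GenFun.mk_eq_mk_iff (netTrace (netDeriv (1, 0) u)).2 ψ.isModerate_scaled).1 hU.initial_dt

theorem isNegligible_trace_dx
    (hU : IsWaveSolution (φ.coefficient c₀ c₁) 0 ψ.delta (GenFun.mk u.1 u.2)) :
    IsNegligible (Domain.whole ℝ) (netTrace (netDeriv (0, 1) u)).1 := by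
  have h := netDeriv_sub_negligible (1 : ℝ) (netTrace u) 0 (by
    rw [ZeroMemClass.coe_zero, sub_zero]; exact isNegligible_trace hU)
  refine h.congr fun ε x _ => ?_
  have h1 : fderivWithin ℝ ((netTrace u).1 ε) (Domain.whole ℝ).carrier x 1 =
      (netDeriv (0, 1) u).1 ε (0, x) := by
    have h2 := hasDerivWithinAt_line (u.2.1 ε) (z := (0, 0)) (v := (0, 1)) (s := univ)
      (fun r _ => by simp [halfPlane]) (mem_univ x)
    simp only [Prod.smul_mk, smul_eq_mul, mul_zero, mul_one, Prod.mk_add_mk, zero_add] at h2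
    have h3 := h2.hasFDerivWithinAt.fderivWithin uniqueDiffWithinAt_univ
    change fderivWithin ℝ (fun r => u.1 ε (0, r)) univ x 1 = _
    rw [h3]
    simp [netDeriv]
  have h4 : fderivWithin ℝ ((0 : moderate (Domain.whole ℝ)).1 ε) (Domain.whole ℝ).carrier x 1 =
      0 := by
    rw [ZeroMemClass.coe_zero]
    simp
  change (netDeriv (0, 1) u).1 ε (0, x) =
    fderivWithin ℝ ((netTrace u).1 ε) (Domain.whole ℝ).carrier x 1 -
      fderivWithin ℝ ((0 : moderate (Domain.whole ℝ)).1 ε) (Domain.whole ℝ).carrier x 1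
  rw [h1, h4, sub_zero]

theorem contDiffAt_of_pos (u : moderate halfPlane) (ε : Scale) {z : ℝ × ℝ} (hz : 0 < z.1) :
    ContDiffAt ℝ ∞ (u.1 ε) z :=
  (u.2.1 ε).contDiffAt (halfPlane_mem_nhds hz)

theorem netDeriv_eq_fderiv (u : moderate halfPlane) (ε : Scale) (v : ℝ × ℝ) {z : ℝ × ℝ}
    (hz : 0 < z.1) : (netDeriv v u).1 ε z = fderiv ℝ (u.1 ε) z v := by
  change fderivWithin ℝ (u.1 ε) halfPlane.carrier z v = _
  rw [fderivWithin_of_mem_nhds (halfPlane_mem_nhds hz)]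

theorem netDeriv_comm (u : moderate halfPlane) (ε : Scale) (a b : ℝ × ℝ) {z : ℝ × ℝ}
    (hz : 0 < z.1) :
    fderiv ℝ ((netDeriv a u).1 ε) z b = fderiv ℝ ((netDeriv b u).1 ε) z a := by
  have h1 : ∀ a b : ℝ × ℝ, fderiv ℝ ((netDeriv a u).1 ε) z b =
      fderiv ℝ (fderiv ℝ (u.1 ε)) z b a := fun a b => by
    have h2 : (netDeriv a u).1 ε =ᶠ[𝓝 z] fun y => fderiv ℝ (u.1 ε) y a := by
      filter_upwards [(isOpen_Ioi.preimage continuous_fst).mem_nhds hz] with y hy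
      exact netDeriv_eq_fderiv u ε a hy
    have h3 : DifferentiableAt ℝ (fderiv ℝ (u.1 ε)) z :=
      ((contDiffAt_of_pos u ε hz).fderiv_right (m := 1)
        (by norm_cast)).differentiableAt (by simp)
    rw [h2.fderiv_eq, fderiv_clm_apply h3 (differentiableAt_const a)]
    simp
  rw [h1, h1]
  exact ((contDiffAt_of_pos u ε hz).isSymmSndFDerivAt
    (by simpa using WithTop.coe_le_coe.2 (le_top : (2 : ℕ∞) ≤ ⊤))).eq b a

theorem waveSystem (c₀ c₁ : ℝ) (φ : Mollifier) (u : moderate halfPlane) (ε : Scale) :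
    WaveSystem (φ.regularize (speed c₀ c₁) ε) (_root_.deriv (φ.regularize (speed c₀ c₁) ε))
      ((netDeriv (1, 0) u).1 ε) ((netDeriv (0, 1) u).1 ε) ((residual φ c₀ c₁ u).1 ε) where
  hasDerivAt_speed t := ((φ.contDiff_regularize (locallyIntegrable_speed c₀ c₁) ε).differentiable
    (by simp) t).hasDerivAt
  continuousOn_v := ((netDeriv (1, 0) u).2.1 ε).continuousOn
  continuousOn_w := ((netDeriv (0, 1) u).2.1 ε).continuousOn
  continuousOn_f := ((residual φ c₀ c₁ u).2.1 ε).continuousOn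
  differentiableAt_v z hz := (contDiffAt_of_pos _ ε hz).differentiableAt (by simp)
  differentiableAt_w z hz := (contDiffAt_of_pos _ ε hz).differentiableAt (by simp)
  symm z hz := netDeriv_comm u ε _ _ hz
  wave z hz := by
    rw [← netDeriv_eq_fderiv _ ε _ hz, ← netDeriv_eq_fderiv _ ε _ hz]
    change _ = _ + ((netDeriv (1, 0) (netDeriv (1, 0) u)).1 ε z -
      (φ.regularize (speed c₀ c₁) ε z.1) ^ 2 * (netDeriv (0, 1) (netDeriv (0, 1) u)).1 ε z)
    ring

/-- The bound for `ε |c_ε'|`. -/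
noncomputable def Mollifier.slope (φ : Mollifier) (c₀ c₁ : ℝ) : ℝ :=
  (|c₀| + |c₁|) * ∫ y, |iteratedDeriv 1 φ.toFun y|

theorem eventually_scattering (hc₀ : 0 < c₀) (hc₁ : 0 < c₁)
    (hU : IsWaveSolution (φ.coefficient c₀ c₁) 0 ψ.delta (GenFun.mk u.1 u.2)) {T : ℝ} (hT : 2 ≤ T)
    (X : ℝ) {q : ℝ} (hq : 0 ≤ q) :
    ∃ C : ℝ, 0 < C ∧ ∃ η : ℝ, 0 < η ∧ ∀ ε : Scale, (ε : ℝ) < η →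
      Scattering c₀ c₁ (min c₀ c₁) (max c₀ c₁) (φ.slope c₀ c₁) T X ε (C * (ε : ℝ) ^ q)
        (ψ.scaled ε) (φ.regularize (speed c₀ c₁) ε)
        (_root_.deriv (φ.regularize (speed c₀ c₁) ε))
        ((netDeriv (1, 0) u).1 ε) ((netDeriv (0, 1) u).1 ε) ((residual φ c₀ c₁ u).1 ε) := by
  obtain ⟨A, hA, η₁, hη₁, h₁⟩ := (isNegligible_residual hU).abs_le
    ((isCompact_Icc (a := 0) (b := T)).prod (isCompact_Icc (a := -X) (b := X)))
    (prod_mono Icc_subset_Ici_self (subset_univ _)) hq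
  obtain ⟨B, hB, η₂, hη₂, h₂⟩ := (isNegligible_trace_dt hU).abs_le
    (isCompact_Icc (a := -X) (b := X)) (subset_univ _) hq
  obtain ⟨D, hD, η₃, hη₃, h₃⟩ := (isNegligible_trace_dx hU).abs_le
    (isCompact_Icc (a := -X) (b := X)) (subset_univ _) hq
  refine ⟨A + B + D + 1, by positivity, min η₁ (min η₂ η₃), by positivity, fun ε hε => ?_⟩
  have hεq : 0 < (ε : ℝ) ^ q := Real.rpow_pos_of_pos ε.2.1 _
  simp only [lt_min_iff] at hε
  obtain ⟨hε₁, hε₂, hε₃⟩ := hε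
  have hle : ∀ C, C ≤ A + B + D + 1 → C * (ε : ℝ) ^ q ≤ (A + B + D + 1) * (ε : ℝ) ^ q :=
    fun C hC => mul_le_mul_of_nonneg_right hC hεq.le
  exact
  { toWaveSystem := waveSystem c₀ c₁ φ u ε
    k_pos := lt_min hc₀ hc₁
    le_speed := φ.le_regularize_speed c₀ c₁ ε
    speed_le := φ.regularize_speed_le c₀ c₁ ε
    eps_pos := ε.2.1
    eps_le := ε.2.2
    speed_left := fun t ht => φ.regularize_speed_left c₀ c₁ ε ht
    speed_right := fun t ht => φ.regularize_speed_right c₀ c₁ ε ht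
    M_nonneg := mul_nonneg (by positivity) (integral_nonneg fun _ => abs_nonneg _)
    deriv_le := fun t => φ.abs_deriv_regularize_le (locallyIntegrable_speed c₀ c₁)
      (abs_speed_le c₀ c₁) ε t
    two_le := hT
    N_pos := mul_pos (by positivity) hεq
    forcing := fun t ht x hx => (h₁ ε hε₁ (t, x) ⟨ht, abs_le.1 hx⟩).trans
      (hle _ (by linarith))
    init_v := fun x hx => (h₂ ε hε₂ x (abs_le.1 hx)).trans (hle _ (by linarith))
    init_w := fun x hx => (h₃ ε hε₃ x (abs_le.1 hx)).trans (hle _ (by linarith))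
    continuous_init := (ψ.contDiff_scaled ε).continuous
    init_eq_zero := fun x hx => ψ.scaled_eq_zero ε hx.le
    integral_init := fun a b ha hb => ψ.intervalIntegral_scaled ε ha hb }

end
end Colombeau

namespace Colombeau

section
variable {E : Type*} [NormedAddCommGroup E] [NormedSpace ℝ E]

theorem derivBound_const {Ω : Domain E} (a : Scale → ℝ) {C η r : ℝ} (hη : 0 < η) (hC : 0 ≤ C)
    (h : ∀ ε : Scale, (ε : ℝ) < η → |a ε| ≤ C * (ε : ℝ) ^ r) (K : Set E) (n : ℕ) :
    DerivBound Ω K n r (fun ε _ => a ε) := by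
  refine ⟨C, η, hη, fun ε hε x _ => ?_⟩
  rcases Nat.eq_zero_or_pos n with rfl | hn
  · rw [norm_iteratedFDerivWithin_zero]
    exact h ε hε
  · rw [iteratedFDerivWithin_const_of_ne hn.ne', Pi.zero_apply, norm_zero]
    exact mul_nonneg hC (Real.rpow_nonneg ε.2.1.le _)

/-- A generalized function that differs from its value at one point by a sup-negligible net is
regular. -/
theorem isRegular_of_sub_value {O : TopologicalSpace.Opens (ℝ × ℝ)} (u : moderate halfPlane)
    {z : ℝ × ℝ} (hz : z ∈ halfPlane.carrier)
    (h : ∀ q : ℝ, 0 ≤ q → ∃ C η : ℝ, 0 < η ∧ ∀ ε : Scale, (ε : ℝ) < η →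
      ∀ y ∈ (halfPlane.inter O).carrier, |u.1 ε y - u.1 ε z| ≤ C * (ε : ℝ) ^ q) :
    ((GenFun.mk u.1 u.2).restrict O).IsRegular := by
  obtain ⟨p, hp, hb⟩ := u.2.2 {z} isCompact_singleton (singleton_subset_iff.2 hz) 0
  obtain ⟨C, hC, η, hη, hC'⟩ := hb.abs_le
  have hconst := derivBound_const (Ω := halfPlane.inter O) (fun ε => u.1 ε z) hη hC
    fun ε hε => hC' ε hε z rfl
  have hmod : IsModerate (halfPlane.inter O) (fun ε _ => u.1 ε z) :=
    ⟨fun _ => contDiffOn_const, fun K _ _ n => ⟨p, hp, hconst K n⟩⟩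
  refine ⟨fun ε _ => u.1 ε z, hmod, ?_, fun K _ _ => ⟨p, hp, hconst K⟩⟩
  refine (GenFun.mk_eq_mk_iff hmod (netRestrict O u).2).2 ?_
  refine isNegligible_of_sup ((⟨_, hmod⟩ : moderate (halfPlane.inter O)) - netRestrict O u).2
    fun K _ hKΩ q hq => ?_
  obtain ⟨C, η, hη, hC⟩ := h q hq
  refine DerivBound.of_abs_le (C := C) hη fun ε hε x hx => ?_
  change |u.1 ε z - u.1 ε x| ≤ _
  rw [abs_sub_comm]
  exact hC ε hε x (hKΩ hx)

end

/-- The signed distance, at fixed time, to the characteristic through the origin that leaves with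
direction `τ` and continues with direction `σ` after the transition. -/
def rayOffset (c₀ c₁ τ σ : ℝ) (z : ℝ × ℝ) : ℝ :=
  z.2 - τ * c₀ * min z.1 1 - σ * c₁ * max (z.1 - 1) 0

theorem continuous_rayOffset (c₀ c₁ τ σ : ℝ) : Continuous (rayOffset c₀ c₁ τ σ) := by
  unfold rayOffset
  fun_prop

/-- The union of the characteristics issuing from the origin. -/
def raySet (c₀ c₁ : ℝ) : Set (ℝ × ℝ) :=
  {z | 0 ≤ z.1 ∧ ∃ τ σ : ℝ, (τ = 1 ∨ τ = -1) ∧ (σ = 1 ∨ σ = -1) ∧ rayOffset c₀ c₁ τ σ z = 0}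

theorem integral_speed (c₀ c₁ : ℝ) {t : ℝ} (ht : 0 ≤ t) :
    ∫ s in (0 : ℝ)..t, speed c₀ c₁ s = c₀ * min t 1 + c₁ * max (t - 1) 0 := by
  have hI : ∀ a b, IntervalIntegrable (speed c₀ c₁) volume a b := fun a b =>
    (locallyIntegrable_speed c₀ c₁).integrableOn_isCompact isCompact_uIcc |>.intervalIntegrable
  have h1 : ∀ a b, a ≤ b → b ≤ 1 → ∫ s in a..b, speed c₀ c₁ s = c₀ * (b - a) := by
    intro a b hab hb
    rw [intervalIntegral.integral_of_le hab, integral_Ioc_eq_integral_Ioo,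
      setIntegral_congr_fun (g := fun _ => c₀) measurableSet_Ioo, setIntegral_const]
    · rw [measureReal_def, Real.volume_Ioo, ENNReal.toReal_ofReal (by linarith), smul_eq_mul,
        mul_comm]
    · intro s hs
      have : ¬ 0 ≤ s - 1 := by linarith [hs.2]
      simp [speed, heaviside, this]
  have h2 : ∀ b, 1 ≤ b → ∫ s in (1 : ℝ)..b, speed c₀ c₁ s = c₁ * (b - 1) := by
    intro b hb
    rw [intervalIntegral.integral_congr (g := fun _ => c₁), intervalIntegral.integral_const,
      smul_eq_mul, mul_comm]
    intro s hs
    rw [uIcc_of_le hb] at hs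
    have : 0 ≤ s - 1 := by linarith [hs.1]
    simp [speed, heaviside, this]
  rcases le_total t 1 with h | h
  · rw [h1 0 t ht h, min_eq_left h, max_eq_right (by linarith)]
    ring
  · rw [← intervalIntegral.integral_add_adjacent_intervals (hI 0 1) (hI 1 t), h1 0 1 (by norm_num)
      le_rfl, h2 t h, min_eq_right h, max_eq_left (by linarith)]
    ring

theorem raySet_eq (c₀ c₁ : ℝ) : raySet c₀ c₁ =
    {z : ℝ × ℝ | 0 ≤ z.1 ∧
        (z.2 = (∫ s in (0 : ℝ)..z.1, speed c₀ c₁ s) ∨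
          z.2 = -(∫ s in (0 : ℝ)..z.1, speed c₀ c₁ s))} ∪
      {z : ℝ × ℝ | 1 ≤ z.1 ∧
        (z.2 = 2 * (∫ s in (0 : ℝ)..1, speed c₀ c₁ s) - (∫ s in (0 : ℝ)..z.1, speed c₀ c₁ s) ∨
          z.2 = -(2 * (∫ s in (0 : ℝ)..1, speed c₀ c₁ s) -
            (∫ s in (0 : ℝ)..z.1, speed c₀ c₁ s)))} := by
  ext ⟨t, x⟩
  simp only [raySet, rayOffset, mem_ofPred_eq, mem_union]
  rw [integral_speed c₀ c₁ zero_le_one, min_self, sub_self, max_self]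
  constructor
  · rintro ⟨ht, τ, σ, hτ, hσ, h⟩
    rw [integral_speed c₀ c₁ ht]
    rcases le_total t 1 with h1 | h1
    · left
      rw [min_eq_left h1, max_eq_right (by linarith)] at h ⊢
      refine ⟨ht, ?_⟩
      rcases hτ with rfl | rfl
      · left; linarith
      · right; linarith
    · rw [min_eq_right h1, max_eq_left (by linarith)] at h ⊢
      rcases hτ with rfl | rfl <;> rcases hσ with rfl | rfl
      · left; exact ⟨ht, .inl (by linarith)⟩
      · right; exact ⟨h1, .inl (by linarith)⟩
      · right; exact ⟨h1, .inr (by linarith)⟩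
      · left; exact ⟨ht, .inr (by linarith)⟩
  · rintro (⟨ht, h⟩ | ⟨ht, h⟩)
    · rw [integral_speed c₀ c₁ ht] at h
      rcases h with h | h
      · exact ⟨ht, 1, 1, .inl rfl, .inl rfl, by linarith⟩
      · exact ⟨ht, -1, -1, .inr rfl, .inr rfl, by linarith⟩
    · have ht0 : 0 ≤ t := by linarith
      rw [integral_speed c₀ c₁ ht0, min_eq_right ht, max_eq_left (by linarith)] at h
      refine ⟨ht0, ?_⟩
      rw [min_eq_right ht, max_eq_left (by linarith)]
      rcases h with h | h
      · exact ⟨1, -1, .inl rfl, .inr rfl, by linarith⟩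
      · exact ⟨-1, 1, .inr rfl, .inl rfl, by linarith⟩

section
variable {c₀ c₁ : ℝ} {φ ψ : Mollifier} {u : moderate halfPlane}

theorem exists_ball_rayOffset {z : ℝ × ℝ} (hz : z ∈ halfPlane.carrier) (hS : z ∉ raySet c₀ c₁) :
    ∃ δ > 0, ∃ ρ > 0, ∀ y ∈ Metric.ball z ρ, ∀ τ σ : ℝ, (τ = 1 ∨ τ = -1) → (σ = 1 ∨ σ = -1) →
      δ < |rayOffset c₀ c₁ τ σ y| := by
  have key : ∀ τ σ : ℝ, (τ = 1 ∨ τ = -1) → (σ = 1 ∨ σ = -1) →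
      ∃ δ > 0, ∀ᶠ y in 𝓝 z, δ < |rayOffset c₀ c₁ τ σ y| := by
    intro τ σ hτ hσ
    have h1 : 0 < |rayOffset c₀ c₁ τ σ z| :=
      abs_pos.2 fun h => hS ⟨hz.1, τ, σ, hτ, hσ, h⟩
    exact ⟨|rayOffset c₀ c₁ τ σ z| / 2, half_pos h1,
      (continuous_rayOffset c₀ c₁ τ σ).abs.continuousAt.eventually_const_lt (half_lt_self h1)⟩
  obtain ⟨δ₁, h₁, e₁⟩ := key 1 1 (.inl rfl) (.inl rfl)
  obtain ⟨δ₂, h₂, e₂⟩ := key 1 (-1) (.inl rfl) (.inr rfl)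
  obtain ⟨δ₃, h₃, e₃⟩ := key (-1) 1 (.inr rfl) (.inl rfl)
  obtain ⟨δ₄, h₄, e₄⟩ := key (-1) (-1) (.inr rfl) (.inr rfl)
  obtain ⟨ρ, hρ, hball⟩ := Metric.eventually_nhds_iff_ball.1 (e₁.and (e₂.and (e₃.and e₄)))
  refine ⟨min (min δ₁ δ₂) (min δ₃ δ₄), by positivity, ρ, hρ, fun y hy τ σ hτ hσ => ?_⟩
  obtain ⟨f₁, f₂, f₃, f₄⟩ := hball y hy
  rcases hτ with rfl | rfl <;> rcases hσ with rfl | rfl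
  · exact ((min_le_left _ _).trans (min_le_left _ _)).trans_lt f₁
  · exact ((min_le_left _ _).trans (min_le_right _ _)).trans_lt f₂
  · exact ((min_le_right _ _).trans (min_le_left _ _)).trans_lt f₃
  · exact ((min_le_right _ _).trans (min_le_right _ _)).trans_lt f₄

/-- Off the characteristics through the origin the solution is locally a generalized constant. -/
theorem exists_isRegular_of_notMem_raySet (hc₀ : 0 < c₀) (hc₁ : 0 < c₁)
    (hU : IsWaveSolution (φ.coefficient c₀ c₁) 0 ψ.delta (GenFun.mk u.1 u.2))
    {z : ℝ × ℝ} (hz : z ∈ halfPlane.carrier) (hS : z ∉ raySet c₀ c₁) :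
    ∃ O : TopologicalSpace.Opens (ℝ × ℝ), z ∈ O ∧
      ((GenFun.mk u.1 u.2).restrict O).IsRegular := by
  obtain ⟨δ, hδ, ρ, hρ, hoff⟩ := exists_ball_rayOffset hz hS
  refine ⟨⟨Metric.ball z ρ, Metric.isOpen_ball⟩, Metric.mem_ball_self hρ,
    isRegular_of_sub_value u hz fun q hq => ?_⟩
  have hz1 : 0 ≤ z.1 := hz.1
  set κ := max c₀ c₁ with hκ
  set k := min c₀ c₁ with hk
  have hκ0 : 0 < κ := lt_max_of_lt_left hc₀
  have hk0 : 0 < k := lt_min hc₀ hc₁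
  set T := z.1 + ρ + 2 with hT
  obtain ⟨C, hC, η, hη, hs⟩ := eventually_scattering hc₀ hc₁ hU (T := T) (by linarith)
    (|z.2| + ρ + κ * (T + 4)) hq
  set A := Scattering.amp k κ (φ.slope c₀ c₁) with hA
  refine ⟨ρ * ((A + T) * C + (A + T) * C / k), min η (δ / (1 + 4 * κ)), by positivity,
    fun ε hε y hy => ?_⟩
  rw [lt_min_iff, lt_div_iff₀ (by positivity)] at hε
  have S := hs ε hε.1
  have hA0 : 0 ≤ A := by linarith [S.le_amp]
  have hT0 : 0 ≤ T := by linarith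
  set N := C * (ε : ℝ) ^ q with hN
  have hN0 : 0 < N := S.N_pos
  have hvw : ∀ y ∈ (halfPlane.carrier ∩ Metric.ball z ρ : Set (ℝ × ℝ)),
      |(netDeriv (1, 0) u).1 ε y| ≤ (A + T) * N ∧
        |(netDeriv (0, 1) u).1 ε y| ≤ (A + T) * N / k := by
    rintro ⟨t, x⟩ ⟨hyH, hyb⟩
    have hd : |t - z.1| < ρ ∧ |x - z.2| < ρ := by
      rw [Metric.mem_ball, Prod.dist_eq, max_lt_iff, Real.dist_eq, Real.dist_eq] at hyb
      exact hyb
    have ht : t ∈ Icc 0 T := ⟨hyH.1, by linarith [(abs_lt.1 hd.1).2]⟩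
    have hx : |x| + κ * (T + 4) ≤ |z.2| + ρ + κ * (T + 4) := by
      linarith [abs_sub_abs_le_abs_sub x z.2, hd.2]
    have hsm : ∀ σ : ℝ, (hσ : σ = 1 ∨ σ = -1) → _ := fun σ hσ => S.small hσ ht hx fun τ hτ => by
      have h1 := hoff (t, x) hyb τ σ hτ hσ
      have h2 : (1 + 4 * κ) * ε < δ := by linarith [hε.2]
      exact h2.trans h1
    have hp := hsm 1 (.inl rfl)
    have hq := hsm (-1) (.inr rfl)
    rw [one_mul] at hp
    rw [neg_one_mul, neg_mul, sub_neg_eq_add] at hq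
    exact ⟨WaveSystem.abs_v_le hp hq, WaveSystem.abs_w_le hk0 (S.le_speed t) hp hq⟩
  have hconv : ∀ r ∈ Icc (0 : ℝ) 1, z + r • (y - z) ∈ halfPlane.carrier ∩ Metric.ball z ρ := by
    intro r hr
    refine ⟨?_, ?_⟩
    · have : Convex ℝ halfPlane.carrier := (convex_Ici 0).prod convex_univ
      exact this.add_smul_sub_mem hz hy.1 hr
    · exact (convex_ball z ρ).add_smul_sub_mem (Metric.mem_ball_self hρ) hy.2 hr
  have hyd : |(y - z).1| ≤ ρ ∧ |(y - z).2| ≤ ρ := by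
    have h1 : y ∈ Metric.ball z ρ := hy.2
    rw [Metric.mem_ball, Prod.dist_eq, max_lt_iff, Real.dist_eq, Real.dist_eq] at h1
    exact ⟨h1.1.le, h1.2.le⟩
  have hmv := norm_image_sub_le_of_norm_deriv_le_segment_01'
    (C := ρ * ((A + T) * N + (A + T) * N / k))
    (fun r hr => hasDerivWithinAt_line (u.2.1 ε) (fun r hr => (hconv r hr).1) hr)
    (fun r hr => by
      obtain ⟨hv, hw⟩ := hvw _ (hconv r (Ico_subset_Icc_self hr))
      have e : y - z = (y - z).1 • ((1 : ℝ), (0 : ℝ)) + (y - z).2 • ((0 : ℝ), (1 : ℝ)) := by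
        ext <;> simp
      have e2 : ∀ L : ℝ × ℝ →L[ℝ] ℝ, L (y - z) = (y - z).1 * L (1, 0) + (y - z).2 * L (0, 1) :=
        fun L => by
          conv_lhs => rw [e]
          rw [map_add, map_smul, map_smul, smul_eq_mul, smul_eq_mul]
      rw [e2, Real.norm_eq_abs, mul_add ρ]
      refine (abs_add_le _ _).trans (add_le_add ?_ ?_)
      · rw [abs_mul]
        exact mul_le_mul hyd.1 hv (abs_nonneg _) hρ.le
      · rw [abs_mul]
        exact mul_le_mul hyd.2 hw (abs_nonneg _) hρ.le)
  simp only [one_smul, zero_smul, add_zero, add_sub_cancel, Real.norm_eq_abs] at hmv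
  refine hmv.trans (le_of_eq ?_)
  rw [hN]
  ring

end
end Colombeau

namespace Colombeau

/-- If a smooth function is small at the `n` points `x + h, …, x + n h`, then it is small at `x`, up
to `h ^ n` times a bound for its `n`-th derivative. -/
theorem abs_le_of_forward_small (n : ℕ) (G : ℕ → ℝ → ℝ) {x h b D : ℝ} (hh : 0 ≤ h)
    (hG : ∀ k, ∀ y ∈ Icc x (x + n * h), HasDerivAt (G k) (G (k + 1) y) y)
    (hD : ∀ y ∈ Icc x (x + n * h), |G n y| ≤ D)
    (hb : ∀ j : ℕ, 1 ≤ j → j ≤ n → |G 0 (x + j * h)| ≤ b) :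
    |G 0 x| ≤ (2 ^ n - 1) * b + h ^ n * D := by
  induction n generalizing G b D with
  | zero =>
    have := hD x (by simp)
    simpa using this
  | succ n ih =>
    push_cast at hG hD
    have hnh : 0 ≤ n * h := by positivity
    have hmem : ∀ y ∈ Icc x (x + n * h), y ∈ Icc x (x + (n + 1) * h) ∧
        y + h ∈ Icc x (x + (n + 1) * h) := fun y hy =>
      ⟨⟨hy.1, by linarith [hy.2]⟩, ⟨by linarith [hy.1], by linarith [hy.2]⟩⟩
    have hadd : ∀ j : ℕ, x + j * h + h = x + (j + 1 : ℕ) * h := fun j => by push_cast; ring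
    have h1 := ih (fun k y => G k (y + h) - G k y) (b := 2 * b) (D := D * h)
      (fun k y hy => ((hG k (y + h) (hmem y hy).2).comp_add_const y h).sub
        (hG k y (hmem y hy).1))
      (fun y hy => by
        have h2 := norm_image_sub_le_of_norm_deriv_le_segment' (a := y) (b := y + h) (C := D)
          (fun s hs => (hG n s ⟨hy.1.trans hs.1, by linarith [hs.2, hy.2]⟩).hasDerivWithinAt)
          (fun s hs => hD s ⟨hy.1.trans hs.1, by linarith [hs.2, hy.2]⟩) (y + h)
          ⟨by linarith, le_rfl⟩
        rwa [add_sub_cancel_left] at h2)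
      (fun j hj1 hjn => by
        have h2 := hb j hj1 (by omega)
        have h3 := hb (j + 1) (by omega) (by omega)
        rw [← hadd] at h3
        exact (abs_sub _ _).trans (by linarith))
    have h2 := hb 1 le_rfl (by omega)
    rw [Nat.cast_one, one_mul] at h2
    have h3 : |G 0 x| ≤ |G 0 (x + h)| + |G 0 (x + h) - G 0 x| := by
      have := abs_sub (G 0 (x + h)) (G 0 (x + h) - G 0 x)
      rwa [sub_sub_cancel] at this
    rw [pow_succ, pow_succ]
    linarith

theorem eq_zero_of_forall_abs_le {J Q η : ℝ} (hη : 0 < η)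
    (h : ∀ ε : Scale, (ε : ℝ) < η → |J| ≤ Q * ε) : J = 0 := by
  by_contra hJ
  have hJ0 : 0 < |J| := abs_pos.2 hJ
  set e := min (η / 2) (min 1 (|J| / (2 * (|Q| + 1)))) with he
  have he0 : 0 < e := by positivity
  have h1 := h ⟨e, he0, (min_le_right _ _).trans (min_le_left _ _)⟩
    ((min_le_left _ _).trans_lt (half_lt_self hη))
  have h2 : e ≤ |J| / (2 * (|Q| + 1)) := (min_le_right _ _).trans (min_le_right _ _)
  rw [le_div_iff₀ (by positivity)] at h2
  have h3 : Q * e ≤ |Q| * e := mul_le_mul_of_nonneg_right (le_abs_self Q) he0.le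
  simp only at h1
  nlinarith [abs_nonneg Q]

section
variable {c₀ c₁ : ℝ} {φ ψ : Mollifier} {u : moderate halfPlane}

/-- The values of the net at time `t` concentrate, with a nonzero mass `J`, on an interval of length
`O(ε)` around `x`. -/
def Concentrates (P : Scale → ℝ → ℝ) (x : ℝ) : Prop :=
  ∃ J : ℝ, J ≠ 0 ∧ ∃ A > 0, ∃ ρ₀ > 0, ∀ ρ, 0 < ρ → ρ ≤ ρ₀ → ∃ B ≥ 0, ∃ η > 0,
    ∀ ε : Scale, (ε : ℝ) < η →
      (∀ y, |y - x| ≤ ρ → A * ε < |y - x| → |P ε y| ≤ B * ε) ∧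
        |(∫ y in (x - ρ)..(x + ρ), P ε y) - J| ≤ B * ε

theorem concentrates_before (hc₀ : 0 < c₀) (hc₁ : 0 < c₁)
    (hU : IsWaveSolution (φ.coefficient c₀ c₁) 0 ψ.delta (GenFun.mk u.1 u.2)) {σ t : ℝ}
    (hσ : σ = 1 ∨ σ = -1) (ht0 : 0 ≤ t) (ht1 : t < 1) :
    Concentrates (fun ε y => (netDeriv (1, 0) u).1 ε (t, y) -
      σ * c₀ * (netDeriv (0, 1) u).1 ε (t, y)) (σ * c₀ * t) := by
  refine ⟨1, one_ne_zero, 1, one_pos, 1, one_pos, fun ρ hρ hρ1 => ?_⟩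
  set κ := max c₀ c₁ with hκ
  have hκ0 : 0 < κ := lt_max_of_lt_left hc₀
  obtain ⟨C, hC, η, hη, hs⟩ := eventually_scattering hc₀ hc₁ hU (T := 2) le_rfl
    (|σ * c₀ * t| + 1 + κ) zero_le_one
  refine ⟨max ((2 + κ) * C) ((2 + κ) * C * (2 * ρ)), le_max_of_le_left (by positivity),
    min η (min (1 - t) ρ), lt_min hη (lt_min (by linarith) hρ), fun ε hε => ?_⟩
  simp only [lt_min_iff] at hε
  have S := hs ε hε.1
  have hε0 : 0 < (ε : ℝ) := ε.2.1
  rw [Real.rpow_one] at S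
  have hX : ∀ y, |y - σ * c₀ * t| ≤ ρ → |y| + κ ≤ |σ * c₀ * t| + 1 + κ := fun y hy => by
    linarith [abs_sub_abs_le_abs_sub y (σ * c₀ * t)]
  have htI : t ∈ Icc 0 (1 - (ε : ℝ)) := ⟨ht0, by linarith [hε.2.1]⟩
  refine ⟨fun y hy hy' => ?_, ?_⟩
  · refine (S.before_small hσ htI (hX y hy) (by linarith)).trans ?_
    rw [← mul_assoc]
    exact mul_le_mul_of_nonneg_right (le_max_left _ _) hε0.le
  · refine (S.integral_before hσ htI (fun y hy => hX y ?_) (by linarith [hε.2.2])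
      (by linarith [hε.2.2])).trans ?_
    · rw [abs_le]
      constructor <;> linarith [hy.1, hy.2]
    · calc _ = (2 + κ) * C * (2 * ρ) * ε := by ring
        _ ≤ _ := mul_le_mul_of_nonneg_right (le_max_right _ _) hε0.le

theorem mass_ne_zero (hc₀ : 0 < c₀) (hc₁ : 0 < c₁) (hne : c₀ ≠ c₁) {σ τ : ℝ}
    (hσ : σ = 1 ∨ σ = -1) (hτ : τ = 1 ∨ τ = -1) : 1 / 2 + σ * τ * c₁ / (2 * c₀) ≠ 0 := by
  have e : 1 / 2 + σ * τ * c₁ / (2 * c₀) = (c₀ + σ * τ * c₁) / (2 * c₀) := by field_simp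
  rw [e]
  refine div_ne_zero ?_ (by positivity)
  have h1 : c₀ - c₁ ≠ 0 := sub_ne_zero.2 hne
  have h2 : c₀ + c₁ ≠ 0 := by positivity
  rcases hσ with rfl | rfl <;> rcases hτ with rfl | rfl
  · simpa using h2
  · simpa [← sub_eq_add_neg] using h1
  · simpa [← sub_eq_add_neg] using h1
  · simpa using h2

theorem concentrates_after (hc₀ : 0 < c₀) (hc₁ : 0 < c₁) (hne : c₀ ≠ c₁)
    (hU : IsWaveSolution (φ.coefficient c₀ c₁) 0 ψ.delta (GenFun.mk u.1 u.2)) {σ τ t : ℝ}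
    (hσ : σ = 1 ∨ σ = -1) (hτ : τ = 1 ∨ τ = -1) (ht1 : 1 < t) :
    Concentrates (fun ε y => (netDeriv (1, 0) u).1 ε (t, y) -
      σ * c₁ * (netDeriv (0, 1) u).1 ε (t, y)) (τ * c₀ + σ * c₁ * (t - 1)) := by
  set κ := max c₀ c₁ with hκ
  set k := min c₀ c₁ with hk
  have hκ0 : 0 < κ := lt_max_of_lt_left hc₀
  refine ⟨1 / 2 + σ * τ * c₁ / (2 * c₀), mass_ne_zero hc₀ hc₁ hne hσ hτ, 1 + 4 * κ, by positivity,
    c₀ / 2, by positivity, fun ρ hρ hρ1 => ?_⟩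
  set x' := τ * c₀ + σ * c₁ * (t - 1) with hx'
  set T := t + 1 with hT
  obtain ⟨C, hC, η, hη, hs⟩ := eventually_scattering hc₀ hc₁ hU (T := T) (by linarith)
    (|x'| + c₀ + κ * T + ρ + κ * (T + 4)) zero_le_one
  set M := φ.slope c₀ c₁ with hM
  refine ⟨max 0 (max ((Scattering.amp k κ M + T) * C)
    ((Scattering.transErr k κ M (2 * ρ) + 2 * ρ * T) * C)), le_max_left _ _,
    min η (min (t - 1) (min (ρ / (1 + 4 * κ)) (c₀ / 2 / (1 + 4 * κ)))),
    lt_min hη (lt_min (by linarith) (by positivity)), fun ε hε => ?_⟩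
  simp only [lt_min_iff, lt_div_iff₀ (by positivity : 0 < 1 + 4 * κ)] at hε
  obtain ⟨hε1, hε2, hε3, hε4⟩ := hε
  have S := hs ε hε1
  have hε0 : 0 < (ε : ℝ) := ε.2.1
  rw [Real.rpow_one] at S
  have htI : t ∈ Icc (1 + (ε : ℝ)) T := ⟨by linarith, by linarith⟩
  have hκT : 0 ≤ κ * T := mul_nonneg hκ0.le (by linarith)
  have hκe : 0 < κ * ε := mul_pos hκ0 hε0
  refine ⟨fun y hy hy' => ?_, ?_⟩
  · refine (S.after_small hσ htI ?_ fun τ' hτ' => ?_).trans ?_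
    · linarith [abs_sub_abs_le_abs_sub y x']
    · rw [abs_le] at hy
      have e : y - σ * c₁ * (t - 1) - τ' * c₀ = (y - x') + (τ * c₀ - τ' * c₀) := by
        rw [hx']; ring
      rw [e]
      rcases hτ with rfl | rfl <;> rcases hτ' with rfl | rfl
      · simpa using hy'
      · rw [lt_abs]; left; linarith
      · rw [lt_abs]; right; linarith
      · simpa using hy'
    · rw [← mul_assoc]
      exact mul_le_mul_of_nonneg_right ((le_max_left _ _).trans (le_max_right _ _)) hε0.le
  · refine (S.integral_after hσ hτ htI (fun y hy => ?_) (by linarith) (by linarith)).trans ?_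
    · linarith [abs_nonneg x']
    · rw [← mul_assoc]
      exact mul_le_mul_of_nonneg_right ((le_max_right _ _).trans (le_max_right _ _)) hε0.le

/-- Iterated `x`-derivatives of a net. -/
noncomputable def iterDx {Ω : Domain (ℝ × ℝ)} (r : moderate Ω) : ℕ → moderate Ω
  | 0 => r
  | n + 1 => netDeriv (0, 1) (iterDx r n)

theorem norm_iteratedFDerivWithin_iterDx_le {Ω : Domain (ℝ × ℝ)} (r : moderate Ω) (ε : Scale)
    {z : ℝ × ℝ} (hz : z ∈ Ω.carrier) (n m : ℕ) :
    ‖iteratedFDerivWithin ℝ m ((iterDx r n).1 ε) Ω.carrier z‖ ≤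
      ‖iteratedFDerivWithin ℝ (m + n) (r.1 ε) Ω.carrier z‖ := by
  induction n generalizing m with
  | zero => exact le_rfl
  | succ n ih =>
    have h1 := norm_iteratedFDerivWithin_dirDeriv_le ((iterDx r n).2.1 ε) (0, 1) m hz
    have h2 : ‖((0 : ℝ), (1 : ℝ))‖ = 1 := by simp [Prod.norm_def]
    rw [h2, one_mul] at h1
    have h3 := ih (m + 1)
    rw [show m + 1 + n = m + (n + 1) by ring] at h3
    exact h1.trans h3

theorem hasDerivAt_iterDx {O : TopologicalSpace.Opens (ℝ × ℝ)} (r : moderate (halfPlane.inter O))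
    (ε : Scale) (n : ℕ) {t x : ℝ} (ht : 0 < t) (hx : (t, x) ∈ O) :
    HasDerivAt (fun y => (iterDx r n).1 ε (t, y)) ((iterDx r (n + 1)).1 ε (t, x)) x := by
  have hopen : IsOpen {y : ℝ | (t, y) ∈ O} := O.isOpen.preimage (by fun_prop)
  have h := hasDerivWithinAt_line ((iterDx r n).2.1 ε) (z := (t, 0)) (v := (0, 1))
    (s := {y | (t, y) ∈ O}) (fun y hy => by
      simp only [Prod.smul_mk, smul_eq_mul, mul_zero, mul_one, Prod.mk_add_mk, add_zero, zero_add]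
      exact ⟨⟨ht.le, mem_univ _⟩, hy⟩) hx
  simp only [Prod.smul_mk, smul_eq_mul, mul_zero, mul_one, Prod.mk_add_mk, add_zero,
    zero_add] at h
  exact h.hasDerivAt (hopen.mem_nhds hx)

/-- A solution is not regular near a point where a Riemann invariant concentrates. -/
theorem not_isRegular_of_concentrates {O : TopologicalSpace.Opens (ℝ × ℝ)} {t x a : ℝ} (ht : 0 < t)
    (hO : (t, x) ∈ O) (hP : Concentrates (fun ε y => (netDeriv (1, 0) u).1 ε (t, y) -
      a * (netDeriv (0, 1) u).1 ε (t, y)) x) :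
    ¬ ((GenFun.mk u.1 u.2).restrict O).IsRegular := by
  rintro ⟨r₀, hr₀, hr₀u, hreg⟩
  have hneg : IsNegligible (halfPlane.inter O) (r₀ - u.1) :=
    (GenFun.mk_eq_mk_iff hr₀ (netRestrict O u).2).1 hr₀u
  obtain ⟨J, hJ, A, hA, ρ₀, hρ₀, hconc⟩ := hP
  obtain ⟨ρ₁, hρ₁, hball⟩ : ∃ ρ₁ > 0, ∀ y, |y - x| ≤ ρ₁ → (t, y) ∈ O := by
    have h1 : {y : ℝ | (t, y) ∈ O} ∈ 𝓝 x :=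
      (O.isOpen.preimage (f := fun y : ℝ => (t, y)) (by fun_prop)).mem_nhds hO
    obtain ⟨ρ₁, hρ₁, h2⟩ := Metric.nhds_basis_closedBall.mem_iff.1 h1
    exact ⟨ρ₁, hρ₁, fun y hy => h2 (by rwa [Metric.mem_closedBall, Real.dist_eq])⟩
  set ρ := min ρ₀ ρ₁ with hρdef
  have hρ : 0 < ρ := lt_min hρ₀ hρ₁
  obtain ⟨B, hB, η₁, hη₁, hcon⟩ := hconc ρ hρ (min_le_left _ _)
  set K : Set (ℝ × ℝ) := {t} ×ˢ Icc (x - ρ) (x + ρ) with hK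
  have hKc : IsCompact K := isCompact_singleton.prod isCompact_Icc
  have hmemO : ∀ y ∈ Icc (x - ρ) (x + ρ), (t, y) ∈ O := fun y hy => hball y (by
    have : ρ ≤ ρ₁ := min_le_right _ _
    rw [abs_le]
    constructor <;> linarith [hy.1, hy.2])
  have hKΩ : K ⊆ (halfPlane.inter O).carrier := by
    rintro ⟨s, y⟩ ⟨hs, hy⟩
    obtain rfl : s = t := hs
    exact ⟨⟨ht.le, mem_univ _⟩, hmemO y hy⟩
  obtain ⟨p, hp, hreg⟩ := hreg K hKc hKΩ
  set r : moderate (halfPlane.inter O) := ⟨r₀, hr₀⟩ with hr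
  set R := netDeriv (1, -a) r with hR
  obtain ⟨n, hn⟩ := exists_nat_ge (p + 1)
  obtain ⟨D, η₂, hη₂, hD⟩ := hreg (n + 1)
  -- the invariant of the regular representative differs by a negligible net
  obtain ⟨B', hB', η₃, hη₃, hdiff⟩ := (netDeriv_sub_negligible (1, -a) r (netRestrict O u)
    hneg).abs_le hKc hKΩ zero_le_one
  set P : Scale → ℝ → ℝ := fun ε y => (netDeriv (1, 0) u).1 ε (t, y) -
      a * (netDeriv (0, 1) u).1 ε (t, y) with hPdef
  have hRP : ∀ ε : Scale, (ε : ℝ) < η₃ → ∀ y ∈ Icc (x - ρ) (x + ρ),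
      |R.1 ε (t, y) - P ε y| ≤ B' * ε := by
    intro ε hε y hy
    have h1 := hdiff ε hε (t, y) ⟨rfl, hy⟩
    rw [Real.rpow_one] at h1
    have h2 : (netDeriv (1, -a) (netRestrict O u)).1 ε (t, y) = P ε y := by
      change fderivWithin ℝ (u.1 ε) (halfPlane.carrier ∩ O) (t, y) (1, -a) =
        fderivWithin ℝ (u.1 ε) halfPlane.carrier (t, y) (1, 0) -
          a * fderivWithin ℝ (u.1 ε) halfPlane.carrier (t, y) (0, 1)
      rw [fderivWithin_inter (O.isOpen.mem_nhds (hmemO y hy))]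
      have e : ((1 : ℝ), -a) = (1, 0) - a • ((0 : ℝ), (1 : ℝ)) := by simp
      rw [e, map_sub, map_smul, smul_eq_mul]
    have h3 : |R.1 ε (t, y) - (netDeriv (1, -a) (netRestrict O u)).1 ε (t, y)| ≤ B' * ε := h1
    rwa [h2] at h3
  have hRn : ∀ ε : Scale, (ε : ℝ) < η₂ → ∀ y ∈ Icc (x - ρ) (x + ρ),
      |(iterDx R n).1 ε (t, y)| ≤ ‖((1 : ℝ), -a)‖ * |D| * (ε : ℝ) ^ (-p) := by
    intro ε hε y hy
    have hyK : (t, y) ∈ K := ⟨rfl, hy⟩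
    have h1 := norm_iteratedFDerivWithin_iterDx_le R ε (hKΩ hyK) n 0
    rw [norm_iteratedFDerivWithin_zero, Real.norm_eq_abs, zero_add] at h1
    have h2 := norm_iteratedFDerivWithin_dirDeriv_le (r.2.1 ε) (1, -a) n (hKΩ hyK)
    rw [mul_assoc]
    refine (h1.trans h2).trans (mul_le_mul_of_nonneg_left ?_ (norm_nonneg _))
    exact (hD ε hε (t, y) hyK).trans (mul_le_mul_of_nonneg_right (le_abs_self D)
      (Real.rpow_nonneg ε.2.1.le _))
  set D' := ‖((1 : ℝ), -a)‖ * |D| with hD'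
  have hD'0 : 0 ≤ D' := by positivity
  set b := 2 ^ n * (B + B') + (3 * A) ^ n * D' with hb
  have h2n : (1 : ℝ) ≤ 2 ^ n := one_le_pow₀ (by norm_num)
  refine hJ (eq_zero_of_forall_abs_le (Q := (b + B') * (2 * ρ) + B)
    (η := min (min η₁ η₂) (min η₃ (ρ / (A * (3 * n + 1))))) (by positivity) fun ε hε => ?_)
  simp only [lt_min_iff, lt_div_iff₀ (by positivity : 0 < A * (3 * (n : ℝ) + 1))] at hε
  obtain ⟨⟨hε1, hε2⟩, hε3, hε4⟩ := hε
  have hε0 : 0 < (ε : ℝ) := ε.2.1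
  obtain ⟨hsmall, hmass⟩ := hcon ε hε1
  have hAe : 0 < A * ε := mul_pos hA hε0
  have hout : ∀ y ∈ Icc (x - ρ) (x + ρ), A * ε < |y - x| → |R.1 ε (t, y)| ≤ (B + B') * ε := by
    intro y hy hyd
    have h1 := hsmall y (by rw [abs_le]; constructor <;> linarith [hy.1, hy.2]) hyd
    have h2 := hRP ε hε3 y hy
    have h3 := abs_sub_abs_le_abs_sub (R.1 ε (t, y)) (P ε y)
    linarith
  have hall : ∀ y ∈ Icc (x - ρ) (x + ρ), |R.1 ε (t, y)| ≤ b * ε := by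
    intro y hy
    rcases lt_or_ge (A * ε) |y - x| with hyd | hyd
    · refine (hout y hy hyd).trans (mul_le_mul_of_nonneg_right ?_ hε0.le)
      have h1 : 0 ≤ (3 * A) ^ n * D' := by positivity
      have h2 : 0 ≤ B + B' := by positivity
      nlinarith
    · rw [abs_le] at hyd
      have hfar : ∀ s : ℝ, 0 ≤ s → s ≤ n → y + s * (3 * A * ε) ∈ Icc (x - ρ) (x + ρ) :=
        fun s hs0 hs => by
          have h1 : s * (3 * A * ε) ≤ n * (3 * A * ε) :=
            mul_le_mul_of_nonneg_right hs (by positivity)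
          have h2 : 0 ≤ s * (3 * A * ε) := by positivity
          exact ⟨by linarith [hy.1], by linarith⟩
      have hseg : ∀ s ∈ Icc y (y + n * (3 * A * ε)), s ∈ Icc (x - ρ) (x + ρ) := fun s hs =>
        ⟨hy.1.trans hs.1, hs.2.trans (hfar n n.cast_nonneg le_rfl).2⟩
      have h1 := abs_le_of_forward_small n (fun k y => (iterDx R k).1 ε (t, y))
        (h := 3 * A * ε) (b := (B + B') * ε) (D := D' * (ε : ℝ) ^ (-p)) (by positivity)
        (fun k s hs => hasDerivAt_iterDx R ε k ht (hmemO s (hseg s hs)))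
        (fun s hs => hRn ε hε2 s (hseg s hs))
        (fun j hj1 hjn => by
          refine hout _ (hfar j j.cast_nonneg (by exact_mod_cast hjn)) ?_
          have h2 : (1 : ℝ) * (3 * A * ε) ≤ j * (3 * A * ε) :=
            mul_le_mul_of_nonneg_right (by exact_mod_cast hj1) (by positivity)
          rw [lt_abs]
          left
          linarith)
      have h2 : (ε : ℝ) ^ n * (ε : ℝ) ^ (-p) ≤ ε := by
        rw [← Real.rpow_natCast, ← Real.rpow_add hε0]
        calc _ ≤ (ε : ℝ) ^ (1 : ℝ) :=
              Real.rpow_le_rpow_of_exponent_ge hε0 ε.2.2 (by linarith)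
          _ = ε := Real.rpow_one _
      have h3 : (3 * A * ε) ^ n * (D' * (ε : ℝ) ^ (-p)) ≤ (3 * A) ^ n * D' * ε := by
        rw [mul_pow]
        calc _ = (3 * A) ^ n * D' * ((ε : ℝ) ^ n * (ε : ℝ) ^ (-p)) := by ring
          _ ≤ _ := mul_le_mul_of_nonneg_left h2 (by positivity)
      have h4 : 0 ≤ (B + B') * ε := by positivity
      refine h1.trans ?_
      rw [hb]
      linarith
  have hPall : ∀ y ∈ Icc (x - ρ) (x + ρ), |P ε y| ≤ (b + B') * ε := fun y hy => by
    have h1 := abs_sub_abs_le_abs_sub (P ε y) (R.1 ε (t, y))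
    rw [abs_sub_comm (P ε y)] at h1
    linarith [hall y hy, hRP ε hε3 y hy]
  have hint := intervalIntegral.norm_integral_le_of_norm_le_const (a := x - ρ) (b := x + ρ)
    (f := P ε) (C := (b + B') * ε) fun y hy => by
      rw [uIoc_of_le (by linarith)] at hy
      exact hPall y ⟨hy.1.le, hy.2⟩
  rw [Real.norm_eq_abs, show x + ρ - (x - ρ) = 2 * ρ by ring, 
    abs_of_pos (by linarith : 0 < 2 * ρ)] at hint
  have h1 := abs_sub_abs_le_abs_sub J (∫ y in (x - ρ)..(x + ρ), P ε y)
  rw [abs_sub_comm J] at h1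
  linarith

/-- Near every point of the characteristics through the origin there is a later point of the same
characteristic at which a Riemann invariant concentrates. -/
theorem not_isRegular_of_mem_raySet (hc₀ : 0 < c₀) (hc₁ : 0 < c₁) (hne : c₀ ≠ c₁)
    (hU : IsWaveSolution (φ.coefficient c₀ c₁) 0 ψ.delta (GenFun.mk u.1 u.2))
    {O : TopologicalSpace.Opens (ℝ × ℝ)} {z : ℝ × ℝ} (hzO : z ∈ O) (hz : z ∈ raySet c₀ c₁) :
    ¬ ((GenFun.mk u.1 u.2).restrict O).IsRegular := by
  obtain ⟨t₀, x₀⟩ := z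
  obtain ⟨ht₀, τ, σ, hτ, hσ, hoff⟩ := hz
  simp only [rayOffset] at ht₀ hoff
  set γ : ℝ → ℝ × ℝ := fun t => (t, τ * c₀ * min t 1 + σ * c₁ * max (t - 1) 0) with hγ
  have hγc : Continuous γ := by fun_prop
  have hγ0 : γ t₀ = (t₀, x₀) := by
    rw [hγ]
    exact Prod.ext rfl (by simp only; linarith)
  have hnh : ∀ᶠ t in 𝓝[>] t₀, γ t ∈ O :=
    (hγc.continuousAt.eventually_mem (O.isOpen.mem_nhds (by rw [hγ0]; exact hzO))).filter_mono
      nhdsWithin_le_nhds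
  rcases lt_or_ge t₀ 1 with h1 | h1
  · have h2 : ∀ᶠ t in 𝓝[>] t₀, t ∈ Ioo t₀ 1 := Ioo_mem_nhdsGT h1
    obtain ⟨t, htO, ht⟩ := (hnh.and h2).exists
    have e : γ t = (t, τ * c₀ * t) := by
      simp only [hγ, min_eq_left ht.2.le, max_eq_right (by linarith [ht.2] : t - 1 ≤ 0), mul_zero,
        add_zero]
    rw [e] at htO
    exact not_isRegular_of_concentrates (ht₀.trans_lt ht.1) htO
      (concentrates_before hc₀ hc₁ hU hτ (ht₀.trans ht.1.le) ht.2)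
  · obtain ⟨t, htO, ht⟩ := (hnh.and self_mem_nhdsWithin).exists
    have ht1 : 1 < t := h1.trans_lt ht
    have e : γ t = (t, τ * c₀ + σ * c₁ * (t - 1)) := by
      simp only [hγ, min_eq_right ht1.le, max_eq_left (by linarith : 0 ≤ t - 1), mul_one]
    rw [e] at htO
    exact not_isRegular_of_concentrates (by linarith) htO
      (concentrates_after hc₀ hc₁ hne hU hσ hτ ht1)

end

theorem singSupp_eq_raySet {c₀ c₁ : ℝ} (hc₀ : 0 < c₀) (hc₁ : 0 < c₁) (hne : c₀ ≠ c₁)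
    {φ ψ : Mollifier} {U : GenFun halfPlane}
    (hU : IsWaveSolution (φ.coefficient c₀ c₁) 0 ψ.delta U) : U.singSupp = raySet c₀ c₁ := by
  obtain ⟨u, rfl⟩ := U.exists_rep
  ext z
  simp only [GenFun.singSupp, Set.mem_sdiff, mem_iUnion, not_exists]
  constructor
  · rintro ⟨hz, h⟩
    by_contra hS
    obtain ⟨O, hzO, hO⟩ := exists_isRegular_of_notMem_raySet hc₀ hc₁ hU hz hS
    exact h O hO hzO
  · intro hz
    exact ⟨⟨hz.1, mem_univ _⟩, fun O hO hzO => not_isRegular_of_mem_raySet hc₀ hc₁ hne hU hzO hz hO⟩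

end Colombeau

theorem theorem4p1 (c₀ c₁ : ℝ) (hc₀ : 0 < c₀) (hc₁ : 0 < c₁) (hne : c₀ ≠ c₁)
    (φ ψ : Colombeau.Mollifier) (U : Colombeau.GenFun Colombeau.halfPlane)
    (hU : Colombeau.IsWaveSolution (φ.coefficient c₀ c₁) 0 ψ.delta U) :
    U.singSupp =
      {z : ℝ × ℝ | 0 ≤ z.1 ∧
        (z.2 = (∫ s in (0 : ℝ)..z.1, Colombeau.speed c₀ c₁ s) ∨
          z.2 = -(∫ s in (0 : ℝ)..z.1, Colombeau.speed c₀ c₁ s))} ∪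
      {z : ℝ × ℝ | 1 ≤ z.1 ∧
        (z.2 = 2 * (∫ s in (0 : ℝ)..1, Colombeau.speed c₀ c₁ s) -
            (∫ s in (0 : ℝ)..z.1, Colombeau.speed c₀ c₁ s) ∨
          z.2 = -(2 * (∫ s in (0 : ℝ)..1, Colombeau.speed c₀ c₁ s) -
            (∫ s in (0 : ℝ)..z.1, Colombeau.speed c₀ c₁ s)))} := by
  rw [Colombeau.singSupp_eq_raySet hc₀ hc₁ hne hU, Colombeau.raySet_eq]
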